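/- **Setting.** Consider problems $\min_{x\in\mathbb R^d} F_0(x):=f_0(x)+g(x)$ subject to $Ax+b=0$, with $A\in\mathbb R^{n\times d}$, $b\in\mathbb R^n$. Such a problem belongs to the *problem class* with constant $L_f$ if $\inf_x F_0(x)>-\infty$; $f_0:\mathbb R^d\to\mathbb R$ is differentiable with $L_f$-Lipschitz gradient; $g:\mathbb R^d\to\mathbb R\cup\{+\infty\}$ is proper, lower semicontinuous and convex; and $g(x)=\bar g(\bar Ax+\bar b)$ with $\bar A\in\mathbb R^{\bar n\times d}$, $\bar b\in\mathbb R^{\bar n}$ and $\bar g:\mathbb R^{\bar n}\to\mathbb R\cup\{+\infty\}$ proper, lower semicontinuous and convex, where $\mathrm{relint}(\mathrm{dom}\,\bar g)\ne\emptyset$ and $\mathrm{dom}\,\bar g$ is not a singleton. A point $x^*$ is *$\epsilon$-stationary* if for some $\gamma\in\mathbb R^n$ both $\mathrm{dist}\bigl(0,\nabla f_0(x^*)+A^\top\gamma+\partial g(x^*)\bigr)\le\epsilon$ and $\|Ax^*+b\|\le\epsilon$; $x$ is *$\omega$-close* to $x^*$ if $\|x-x^*\|\le\omega$. For a matrix $B$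 let $\kappa(B)=\sqrt{\lambda_{\max}(BB^\top)/\lambda^+_{\min}(BB^\top)}$, with $\lambda^+_{\min}$ the smallest positive eigenvalue, let $[\bar A;A]$ be $\bar A$ stacked on $A$, and let $\Delta_{F_0}=F_0(x^{(0)})-\inf_x F_0(x)$. A first-order method (FOM) in the *algorithm class* uses the oracle $\mathrm{ORACLE}_1(x,z,\eta)=\bigl(\nabla f_0(x),Ax,A^\top z,\mathrm{prox}_{\eta g}(x)\bigr)$, where $\mathrm{prox}_{\eta g}(x)=\arg\min_{x'}\{g(x')+\frac1{2\eta}\|x'-x\|^2\}$. From $x^{(0)}$ it generates iterates such that, for every $t\ge1$, $x^{(t)}\in\mathrm{span}\{\xi^{(t)},\mathrm{prox}_{\eta_tg}(\xi^{(t)})\}$ for some $\eta_t>0$ and some $\xi^{(t)}\in\mathrm{span}\{x^{(s)},\nabla f_0(x^{(s)}),A^\top b,A^\top Ax^{(s)}: 0\le s\le t-1\}$. Every iteration counts as at least one call to $\mathrm{ORACLE}_1$. The methods start at $x^{(0)}=0$. **Instance $\mathcal P$.** Let $\epsilon>0$, $L_f>0$, and let $m_1\ge2$, $m_2\ge1$,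 $\bar d\ge5$ be integers with $m_1m_2$ even and $\bar d$ odd. Put $m=3m_1m_2$, $d=m\bar d$, and write $x=(x_1,\dots,x_m)$ with $x_i\in\mathbb R^{\bar d}$. Let $J_m\in\mathbb R^{(m-1)\times m}$ have rows $e_{i+1}^\top-e_i^\top$, let $\mathcal M=\{im_1: i=1,\dots,3m_2-1\}$, and let $\mathcal M^C=\{1,\dots,m-1\}\setminus\mathcal M$. Let $J_{\mathcal M}$, $J_{\mathcal M^C}$ be the corresponding row submatrices of $J_m$ and $$\bar A=mL_f\,J_{\mathcal M}\otimes I_{\bar d},\quad A=mL_f\,J_{\mathcal M^C}\otimes I_{\bar d},\quad b=0,\quad\bar b=0,\quad \bar g(y)=\tfrac{\beta}{mL_f}\|y\|_1,$$ so that $g(x)=\beta\sum_{i\in\mathcal M}\|x_i-x_{i+1}\|_1$, where $\beta>(50\pi+1+\|A\|)\sqrt m\,\epsilon$ and $\|A\|$ is the spectral norm. Let $\Psi(u)=0$ for $u\le0$, $\Psi(u)=1-e^{-u^2}$ for $u>0$, and $\Phi(v)=4\arctan v+2\pi$. For $z\in\mathbb R^{\bar d}$ let $\varphi(z,1)=-\Psi(1)\Phi(z_1)$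 and $\varphi(z,j)=\Psi(-z_{j-1})\Phi(-z_j)-\Psi(z_{j-1})\Phi(z_j)$ for $2\le j\le\bar d$. Let $h_i(z)$ be $\varphi(z,1)+3\sum_{j=1}^{\lfloor\bar d/2\rfloor}\varphi(z,2j)$ if $1\le i\le\frac m3$, $\varphi(z,1)$ if $\frac m3+1\le i\le\frac{2m}3$, and $\varphi(z,1)+3\sum_{j=1}^{\lfloor\bar d/2\rfloor}\varphi(z,2j+1)$ if $\frac{2m}3+1\le i\le m$. Finally $$f_0(x)=\sum_{i=1}^m f_i(x_i),\qquad f_i(z)=\frac{300\pi\epsilon^2}{mL_f}\,h_i\!\left(\frac{\sqrt m\,L_f\,z}{150\pi\epsilon}\right).$$ **Theorem.** Let $\epsilon>0$, $L_f>0$ and $\omega\in[0,\frac{150\pi\epsilon}{L_f})$. Then there is an instance in the problem class with constant $L_f$, namely the instance $\mathcal P$ for any admissible $m_1,m_2,\bar d,\beta$ (such parameters exist), such that every FOM in the algorithm class, started at $x^{(0)}=0$, needs at least $$\left\lceil\frac{\kappa([\bar A;A])\,L_f\,\Delta_{F_0}}{36000\pi^2}\,\epsilon^{-2}\right\rceil$$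 calls to $\mathrm{ORACLE}_1$ to obtain an iterate that is $\omega$-close to an $\epsilon$-stationary point of the instance. -/

import Mathlib

open scoped Kronecker InnerProductSpace

noncomputable section

namespace FOMLower

/-! ### Convex analysis for extended-real-valued functions -/

/-- Proper, lower semicontinuous and convex (the last through the epigraph). -/
structure ProperLscConvex {E : Type*} [NormedAddCommGroup E] [InnerProductSpace ℝ E]
    (g : E → EReal) : Prop where
  ne_bot : ∀ x, g x ≠ ⊥
  ne_top : ∃ x, g x ≠ ⊤
  lsc : LowerSemicontinuous g
  convex : Convex ℝ {p : E × ℝ | g p.1 ≤ (p.2 : EReal)}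

/-- The effective domain of `g`. -/
def dom {E : Type*} (g : E → EReal) : Set E := {x | g x ≠ ⊤}

/-- The convex subdifferential of `g` at `x`. -/
def subdiff {E : Type*} [NormedAddCommGroup E] [InnerProductSpace ℝ E]
    (g : E → EReal) (x : E) : Set E :=
  {v | ∀ y, g x + ((⟪v, y - x⟫_ℝ : ℝ) : EReal) ≤ g y}

/-- The set of minimizers of `x' ↦ g x' + ‖x' - x‖² / (2η)`; it is the singleton consisting of
the value at `x` of the proximal mapping of `η g` when `g` is proper, lower semicontinuous and
convex and `η > 0`. -/
def prox {E : Type*} [NormedAddCommGroup E] [InnerProductSpace ℝ E]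
    (η : ℝ) (g : E → EReal) (x : E) : Set E :=
  {p | ∀ x', g p + ((1 / (2 * η) * ‖p - x‖ ^ 2 : ℝ) : EReal)
      ≤ g x' + ((1 / (2 * η) * ‖x' - x‖ ^ 2 : ℝ) : EReal)}

/-- Multiplication of a Euclidean vector by a matrix. -/
def mv {ι ν : Type} [Fintype ι] [DecidableEq ι] [Fintype ν]
    (A : Matrix ν ι ℝ) (x : EuclideanSpace ℝ ι) : EuclideanSpace ℝ ν :=
  A.toEuclideanLin x

/-- The spectral norm of a matrix. -/
def specNorm {ι ν : Type} [Fintype ι] [DecidableEq ι] [Fintype ν] (A : Matrix ν ι ℝ) : ℝ :=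
  ‖LinearMap.toContinuousLinearMap A.toEuclideanLin‖

/-- `√(λ_max(B Bᵀ) / λ⁺_min(B Bᵀ))`, with `λ⁺_min` the smallest positive eigenvalue. -/
def condNumber {ι ν : Type} [Fintype ι] [Fintype ν] [DecidableEq ν] (B : Matrix ν ι ℝ) : ℝ :=
  Real.sqrt (sSup (spectrum ℝ (B * B.transpose)) /
    sInf {l | l ∈ spectrum ℝ (B * B.transpose) ∧ 0 < l})

/-! ### Affinely constrained composite problems -/

/-- Data of the problem `min f₀(x) + g(x)` subject to `A x + b = 0`,
where `g(x) = ḡ(Ā x + b̄)`. -/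
structure Problem (ι ν μ : Type) where
  f₀ : EuclideanSpace ℝ ι → ℝ
  A : Matrix ν ι ℝ
  b : EuclideanSpace ℝ ν
  gbar : EuclideanSpace ℝ μ → EReal
  Abar : Matrix μ ι ℝ
  bbar : EuclideanSpace ℝ μ

namespace Problem

variable {ι ν μ : Type} [Fintype ι] [DecidableEq ι] [Fintype ν] [DecidableEq ν]
  [Fintype μ] [DecidableEq μ]

/-- The regularizer `g(x) = ḡ(Ā x + b̄)`. -/
def g (P : Problem ι ν μ) (x : EuclideanSpace ℝ ι) : EReal :=
  P.gbar (mv P.Abar x + P.bbar)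

/-- The objective `F₀ = f₀ + g`. -/
def F₀ (P : Problem ι ν μ) (x : EuclideanSpace ℝ ι) : EReal :=
  (P.f₀ x : EReal) + P.g x

/-- The initial gap `F₀(x⁰) - inf F₀`. -/
def gap (P : Problem ι ν μ) (x0 : EuclideanSpace ℝ ι) : ℝ :=
  (P.F₀ x0 - ⨅ x, P.F₀ x).toReal

/-- The condition number of the stacked matrix `[Ā; A]`. -/
def jointCond (P : Problem ι ν μ) : ℝ :=
  condNumber (Matrix.fromRows P.Abar P.A)

/-- Membership in the problem class with smoothness constant `L`. -/
structure InClass (P : Problem ι ν μ) (L : ℝ) : Prop where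
  bddBelow : ⊥ < ⨅ x, P.F₀ x
  differentiable : Differentiable ℝ P.f₀
  smooth : ∀ x x', ‖gradient P.f₀ x - gradient P.f₀ x'‖ ≤ L * ‖x - x'‖
  g_properLscConvex : ProperLscConvex P.g
  gbar_properLscConvex : ProperLscConvex P.gbar
  relint_nonempty : (intrinsicInterior ℝ (dom P.gbar)).Nonempty
  not_singleton : ¬ ∃ y, dom P.gbar = {y}

/-- `x` is an `ε`-stationary point: for some multiplier `γ`,
`dist(0, ∇f₀(x) + Aᵀγ + ∂g(x)) ≤ ε` and `‖A x + b‖ ≤ ε`.  The extended distance is used, so that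
the distance to the empty set is infinite. -/
def IsStationary (P : Problem ι ν μ) (ε : ℝ) (x : EuclideanSpace ℝ ι) : Prop :=
  ∃ γ : EuclideanSpace ℝ ν,
    Metric.infEDist 0 ((fun v => gradient P.f₀ x + mv P.A.transpose γ + v) '' subdiff P.g x)
        ≤ ENNReal.ofReal ε ∧
      ‖mv P.A x + P.b‖ ≤ ε

/-- `x` is `ω`-close to an `ε`-stationary point. -/
def IsNearStationary (P : Problem ι ν μ) (ω ε : ℝ) (x : EuclideanSpace ℝ ι) : Prop :=
  ∃ y, P.IsStationary ε y ∧ ‖x - y‖ ≤ ω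

/-- The first-order information at the iterates `x⁽⁰⁾, …, x⁽ᵗ⁻¹⁾`. -/
def info (P : Problem ι ν μ) (x : ℕ → EuclideanSpace ℝ ι) (t : ℕ) :
    Set (EuclideanSpace ℝ ι) :=
  {v | ∃ s < t, v = x s ∨ v = gradient P.f₀ (x s) ∨ v = mv P.A.transpose P.b ∨
    v = mv P.A.transpose (mv P.A (x s))}

/-- A run, from `x0`, of a first-order method that uses the oracle
`(x, z, η) ↦ (∇f₀(x), A x, Aᵀ z, prox_{ηg}(x))`.  The oracle calls are counted:
`calls t` is the number of calls made until `x t` is available, and every iteration makes at least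
one call (several are allowed, for instance to form `Aᵀ A x`). -/
structure FOMRun (P : Problem ι ν μ) (x0 : EuclideanSpace ℝ ι) where
  x : ℕ → EuclideanSpace ℝ ι
  calls : ℕ → ℕ
  init : x 0 = x0
  step : ∀ t, 1 ≤ t → ∃ ξ ∈ Submodule.span ℝ (P.info x t), ∃ η : ℝ, 0 < η ∧
    ∃ p ∈ prox η P.g ξ, x t ∈ Submodule.span ℝ {ξ, p}
  calls_lt : ∀ t, calls t < calls (t + 1)

end Problem

/-! ### The hard instance

Blocks `i = 1, …, m` and coordinates `j = 1, …, d̄` are represented by `Fin m × Fin d̄`, shifted to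
start at zero, and `m = 3 m₁ m₂`. -/

/-- The matrix `J_m` of size `(m-1) × m`, with rows `e_{i+1} - e_i`. -/
def J (m : ℕ) : Matrix (Fin (m - 1)) (Fin m) ℝ :=
  fun i k => if k.val = i.val then -1 else if k.val = i.val + 1 then 1 else 0

/-- The rows of `J_m` with (one-based) number in `𝓜 = {k m₁ | k = 1, …, 3 m₂ - 1}`. -/
def setM (m₁ m₂ : ℕ) : Finset (Fin (3 * m₁ * m₂ - 1)) :=
  Finset.univ.filter fun i => i.val + 1 ∈ (Finset.Icc 1 (3 * m₂ - 1)).image (fun k => k * m₁)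

/-- `m L (J_S ⊗ I_d̄)`, where `J_S` consists of the rows of `J_m` in `S`. -/
def blockMatrix (m dbar : ℕ) (L : ℝ) (S : Finset (Fin (m - 1))) :
    Matrix (S × Fin dbar) (Fin m × Fin dbar) ℝ :=
  ((m : ℝ) * L) • ((J m).submatrix (fun i : S => i.val) id ⊗ₖ (1 : Matrix (Fin dbar) (Fin dbar) ℝ))

def Psi (u : ℝ) : ℝ := if u ≤ 0 then 0 else 1 - Real.exp (-u ^ 2)

def Phi (v : ℝ) : ℝ := 4 * Real.arctan v + 2 * Real.pi

/-- The `j`-th coordinate of `z`, for `j = 1, …, d̄`. -/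
def coord {dbar : ℕ} (z : Fin dbar → ℝ) (j : ℕ) : ℝ :=
  if h : 1 ≤ j ∧ j ≤ dbar then z ⟨j - 1, by omega⟩ else 0

/-- The function `φ(z, j)`, for `j = 1, …, d̄`. -/
def varphi {dbar : ℕ} (z : Fin dbar → ℝ) (j : ℕ) : ℝ :=
  if j = 1 then -Psi 1 * Phi (coord z 1)
  else Psi (-coord z (j - 1)) * Phi (-coord z j) - Psi (coord z (j - 1)) * Phi (coord z j)

/-- The function `h_i`, for `i = 1, …, m`, where `third = m / 3`. -/
def h {dbar : ℕ} (third i : ℕ) (z : Fin dbar → ℝ) : ℝ :=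
  if i ≤ third then varphi z 1 + 3 * ∑ j ∈ Finset.Icc 1 (dbar / 2), varphi z (2 * j)
  else if i ≤ 2 * third then varphi z 1
  else varphi z 1 + 3 * ∑ j ∈ Finset.Icc 1 (dbar / 2), varphi z (2 * j + 1)

/-- The function `f_i`, for `i = 1, …, m`, with `m = 3 * third`. -/
def fComp {dbar : ℕ} (ε L : ℝ) (third i : ℕ) (z : Fin dbar → ℝ) : ℝ :=
  300 * Real.pi * ε ^ 2 / (((3 * third : ℕ) : ℝ) * L) *
    h third i (fun j => Real.sqrt ((3 * third : ℕ) : ℝ) * L * z j / (150 * Real.pi * ε))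

/-- The hard instance: `f₀(x) = ∑ i, f_i(x_i)`, `ḡ(y) = β / (m L) ‖y‖₁`, the rows of
`m L (J_m ⊗ I)` in `𝓜` form `Ā`, the others form `A`, and `b = 0`, `b̄ = 0`.  Thus
`g(x) = β ∑_{i ∈ 𝓜} ‖x_i - x_{i+1}‖₁`. -/
def hardInstance (ε L : ℝ) (m₁ m₂ dbar : ℕ) (β : ℝ) :
    Problem (Fin (3 * m₁ * m₂) × Fin dbar)
      (((setM m₁ m₂)ᶜ : Finset (Fin (3 * m₁ * m₂ - 1))) × Fin dbar)
      (setM m₁ m₂ × Fin dbar) where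
  f₀ x := ∑ i : Fin (3 * m₁ * m₂), fComp ε L (m₁ * m₂) (i.val + 1) (fun j => x (i, j))
  A := blockMatrix (3 * m₁ * m₂) dbar L (setM m₁ m₂)ᶜ
  b := 0
  gbar y := ((β / (((3 * m₁ * m₂ : ℕ) : ℝ) * L) * ∑ k, |y k| : ℝ) : EReal)
  Abar := blockMatrix (3 * m₁ * m₂) dbar L (setM m₁ m₂)
  bbar := 0

/-- The admissible parameters of the hard instance. -/
structure Admissible (ε L : ℝ) (m₁ m₂ dbar : ℕ) (β : ℝ) : Prop where
  two_le : 2 ≤ m₁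
  one_le : 1 ≤ m₂
  even : Even (m₁ * m₂)
  five_le : 5 ≤ dbar
  odd : Odd dbar
  beta_gt : (50 * Real.pi + 1 + specNorm (hardInstance ε L m₁ m₂ dbar β).A) *
    Real.sqrt ((3 * m₁ * m₂ : ℕ) : ℝ) * ε < β

end FOMLower

end

noncomputable section

namespace FOMLower

/-! ### The scalar building blocks -/

/-! The objective is a chain: `φ(z, j)` couples only the coordinates `j - 1` and `j`, and it is flat
in `z_j` while `z_{j-1} = 0` and flat in `z_{j-1}` while `z_{j-1} = 0`. From the origin, coordinates
therefore wake up one after another. The links are spread over a path of `m` blocks: links with even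
`j` sit in the first third, those with odd `j ≥ 3` in the last. Blocks communicate only with
neighbours, through `AᵀA` or through the prox, so waking one more coordinate costs a journey across
the middle third, of length `m/3 = m₁m₂`. An iteration advances at most two blocks, one when `ξ` is
formed and one in the prox (the edges in `𝓜` are pairwise disjoint because `m₁ ≥ 2`). Hence the last
coordinate stays zero in every block while `2t < (d̄ - 2) m₁m₂` (`iterate_last_eq_zero`).

Such a point is far from stationarity (`not_isNearStationary`). At a stationary point the large `β`
forces equality across the edges in `𝓜`, and the small residual `Ax` forces near equality across the
others, so all blocks nearly coincide. Shifting coordinate `j` in all blocks at once changes neither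
`Ax` nor `g`; stationarity tested in this direction thus bounds the sum over `i` of the `j`-th
partial derivatives of the `f_i` by `ε√m`. If some rescaled coordinate is below `1` in absolute
value, the first such `j` has an active predecessor, and that sum is below `-ε√m`, a contradiction.

It remains to compare constants. All eigenvalues of the stacked Gram matrix lie in `[L², 4m²L²]`, so
the condition number is at most `2m` (`jointCond_le`), and the initial gap is at most `1200π²ε²(d̄ -
1/2)/L` (`gap_le`). The claimed bound is then at most `(d̄ - 2) m₁m₂ / 2` (`bound_le`). -/

/-- The even part `Ψ(a) + Ψ(-a)`. -/
def evenPsi (a : ℝ) : ℝ := 1 - Real.exp (-a ^ 2)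

/-- The derivative of `evenPsi`. -/
def evenPsi' (a : ℝ) : ℝ := 2 * a * Real.exp (-a ^ 2)

/-- The odd part `Ψ(a) - Ψ(-a)`. -/
def oddPsi (a : ℝ) : ℝ := Psi a - Psi (-a)

/-- The function of two consecutive coordinates from which every `φ(z, j)` is formed. -/
def link (a b : ℝ) : ℝ := -(2 * Real.pi * oddPsi a) - 4 * evenPsi a * Real.arctan b

/-- The partial derivative of `link` in its first argument. -/
def linkFst (a b : ℝ) : ℝ := -(2 * Real.pi * |evenPsi' a|) - 4 * evenPsi' a * Real.arctan b

/-- The partial derivative of `link` in its second argument. -/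
def linkSnd (a b : ℝ) : ℝ := -(4 * evenPsi a * (1 / (1 + b ^ 2)))

lemma hasDerivAt_evenPsi (a : ℝ) : HasDerivAt evenPsi (evenPsi' a) a := by
  have h := ((hasDerivAt_pow 2 a).neg.exp).const_sub 1
  refine (h.congr_deriv ?_)
  simp [evenPsi']; ring

lemma evenPsi_zero : evenPsi 0 = 0 := by simp [evenPsi]

lemma evenPsi'_zero : evenPsi' 0 = 0 := by simp [evenPsi']

lemma evenPsi_neg (a : ℝ) : evenPsi (-a) = evenPsi a := by simp [evenPsi]

lemma Psi_of_nonpos {a : ℝ} (ha : a ≤ 0) : Psi a = 0 := by simp [Psi, ha]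

lemma Psi_of_nonneg {a : ℝ} (ha : 0 ≤ a) : Psi a = evenPsi a := by
  rcases ha.eq_or_lt with rfl | h
  · simp [Psi, evenPsi]
  · simp [Psi, evenPsi, h]

lemma evenPsi_eq (a : ℝ) : evenPsi a = Psi a + Psi (-a) := by
  rcases le_total a 0 with h | h
  · rw [Psi_of_nonpos h, Psi_of_nonneg (by linarith), evenPsi_neg, zero_add]
  · rw [Psi_of_nonneg h, Psi_of_nonpos (by linarith : -a ≤ 0), add_zero]

lemma evenPsi_nonneg (a : ℝ) : 0 ≤ evenPsi a := by
  have : Real.exp (-a ^ 2) ≤ 1 := Real.exp_le_one_iff.2 (by nlinarith [sq_nonneg a])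
  unfold evenPsi; linarith

lemma evenPsi_le_one (a : ℝ) : evenPsi a ≤ 1 := by
  have := Real.exp_pos (-a ^ 2)
  unfold evenPsi; linarith

lemma half_lt_evenPsi {a : ℝ} (ha : 1 ≤ |a|) : 1 / 2 < evenPsi a := by
  have h1 : (1 : ℝ) ≤ a ^ 2 := by rw [← sq_abs]; nlinarith
  have h2 : Real.exp (-a ^ 2) ≤ Real.exp (-1) := Real.exp_le_exp.2 (by linarith)
  have h3 := Real.exp_neg_one_lt_half
  unfold evenPsi; linarith

lemma Psi_nonneg (a : ℝ) : 0 ≤ Psi a := by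
  rcases le_total a 0 with h | h
  · rw [Psi_of_nonpos h]
  · rw [Psi_of_nonneg h]; exact evenPsi_nonneg a

lemma abs_oddPsi_le (a : ℝ) : |oddPsi a| ≤ evenPsi a := by
  rw [evenPsi_eq, oddPsi, abs_le]
  constructor <;> linarith [Psi_nonneg a, Psi_nonneg (-a)]

/-- The two branches meet at the origin with slope zero on both sides, so they glue there; elsewhere
one branch prevails locally. -/
lemma hasDerivAt_Psi (a : ℝ) : HasDerivAt Psi (max (evenPsi' a) 0) a := by
  rcases lt_trichotomy a 0 with h | rfl | h
  · have h0 : evenPsi' a ≤ 0 := by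
      have := Real.exp_pos (-a ^ 2)
      unfold evenPsi'; nlinarith
    rw [max_eq_right h0]
    refine (hasDerivAt_const a (0 : ℝ)).congr_of_eventuallyEq ?_
    filter_upwards [Iio_mem_nhds h] with u hu
    exact Psi_of_nonpos (le_of_lt hu)
  · rw [evenPsi'_zero, max_self]
    have h1 : HasDerivWithinAt Psi 0 (Set.Iic 0) 0 :=
      (hasDerivWithinAt_const (0 : ℝ) _ (0 : ℝ)).congr (fun u hu => Psi_of_nonpos hu)
        (Psi_of_nonpos le_rfl)
    have h2 : HasDerivWithinAt Psi 0 (Set.Ici 0) 0 := by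
      have := (hasDerivAt_evenPsi 0).hasDerivWithinAt (s := Set.Ici 0)
      rw [evenPsi'_zero] at this
      exact this.congr (fun u hu => Psi_of_nonneg hu) (Psi_of_nonneg le_rfl)
    have := h1.union h2
    rwa [Set.Iic_union_Ici, hasDerivWithinAt_univ] at this
  · have h0 : 0 ≤ evenPsi' a := by
      have := Real.exp_pos (-a ^ 2)
      unfold evenPsi'; positivity
    rw [max_eq_left h0]
    refine (hasDerivAt_evenPsi a).congr_of_eventuallyEq ?_
    filter_upwards [Ioi_mem_nhds h] with u hu
    exact Psi_of_nonneg (le_of_lt hu)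

lemma evenPsi'_neg (a : ℝ) : evenPsi' (-a) = -evenPsi' a := by simp [evenPsi']

lemma hasDerivAt_oddPsi (a : ℝ) : HasDerivAt oddPsi |evenPsi' a| a := by
  have h := (hasDerivAt_Psi a).sub ((hasDerivAt_Psi (-a)).comp a (hasDerivAt_neg a))
  refine h.congr_deriv ?_
  rw [evenPsi'_neg]
  rcases le_total (evenPsi' a) 0 with h | h
  · rw [max_eq_right h, max_eq_left (by linarith), abs_of_nonpos h]; ring
  · rw [max_eq_left h, max_eq_right (by linarith), abs_of_nonneg h]; ring

lemma abs_evenPsi'_le_one (a : ℝ) : |evenPsi' a| ≤ 1 := by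
  have h1 : a ^ 2 + 1 ≤ Real.exp (a ^ 2) := Real.add_one_le_exp _
  have h2 : Real.exp (-a ^ 2) * Real.exp (a ^ 2) = 1 := by rw [← Real.exp_add]; simp
  have h3 := Real.exp_pos (-a ^ 2)
  have h4 : |2 * a| ≤ Real.exp (a ^ 2) := by
    refine le_trans ?_ h1
    rw [abs_le]; constructor <;> nlinarith [sq_nonneg (a - 1), sq_nonneg (a + 1)]
  rw [evenPsi', abs_mul, abs_of_pos h3]
  nlinarith

lemma hasDerivAt_evenPsi' (a : ℝ) :
    HasDerivAt evenPsi' ((2 - 4 * a ^ 2) * Real.exp (-a ^ 2)) a := by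
  have h := ((hasDerivAt_id a).const_mul 2).mul ((hasDerivAt_pow 2 a).neg.exp)
  refine h.congr_deriv ?_
  simp; ring

lemma abs_evenPsi'_sub_le (a b : ℝ) : |evenPsi' a - evenPsi' b| ≤ 2 * |a - b| := by
  refine Convex.norm_image_sub_le_of_norm_hasDerivWithin_le (s := Set.univ) (𝕜 := ℝ)
    (f' := fun a => (2 - 4 * a ^ 2) * Real.exp (-a ^ 2))
    (fun x _ => (hasDerivAt_evenPsi' x).hasDerivWithinAt) (fun x _ => ?_) convex_univ
    (Set.mem_univ _) (Set.mem_univ _)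
  -- The second derivative is bounded by `2` because `|2 - 4x²| ≤ 2 + 2x² + x⁴ ≤ 2 exp(x²)`; the
  -- linear bound on `exp` would not give this.
  have h1 : 1 + x ^ 2 + (x ^ 2) ^ 2 / 2 ≤ Real.exp (x ^ 2) :=
    Real.quadratic_le_exp_of_nonneg (sq_nonneg x)
  have h2 : Real.exp (-x ^ 2) * Real.exp (x ^ 2) = 1 := by rw [← Real.exp_add]; simp
  have h3 := Real.exp_pos (-x ^ 2)
  have h4 : |2 - 4 * x ^ 2| ≤ 2 * Real.exp (x ^ 2) := by
    rw [abs_le]; constructor <;> nlinarith [sq_nonneg (x ^ 2 - 1), sq_nonneg x]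
  rw [Real.norm_eq_abs, abs_mul, abs_of_pos h3]
  nlinarith

lemma abs_evenPsi_sub_le (a b : ℝ) : |evenPsi a - evenPsi b| ≤ |a - b| := by
  have := Convex.norm_image_sub_le_of_norm_hasDerivWithin_le (s := Set.univ) (𝕜 := ℝ)
    (fun x _ => (hasDerivAt_evenPsi x).hasDerivWithinAt)
    (fun x _ => abs_evenPsi'_le_one x) convex_univ (Set.mem_univ b) (Set.mem_univ a)
  simpa using this

lemma one_div_one_add_sq_pos (b : ℝ) : 0 < 1 / (1 + b ^ 2) := by positivity

lemma one_div_one_add_sq_le (b : ℝ) : 1 / (1 + b ^ 2) ≤ 1 := by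
  rw [div_le_one (by positivity)]; nlinarith [sq_nonneg b]

lemma abs_arctan_sub_le (a b : ℝ) : |Real.arctan a - Real.arctan b| ≤ |a - b| := by
  have := Convex.norm_image_sub_le_of_norm_hasDerivWithin_le (s := Set.univ) (𝕜 := ℝ) (C := 1)
    (fun x _ => (Real.hasDerivAt_arctan x).hasDerivWithinAt)
    (fun x _ => by
      rw [Real.norm_eq_abs, abs_of_pos (one_div_one_add_sq_pos x)]
      exact one_div_one_add_sq_le x) convex_univ (Set.mem_univ b) (Set.mem_univ a)
  simpa using this

lemma abs_one_div_one_add_sq_sub_le (b c : ℝ) :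
    |1 / (1 + b ^ 2) - 1 / (1 + c ^ 2)| ≤ |b - c| := by
  have hb : (0 : ℝ) < 1 + b ^ 2 := by positivity
  have hc : (0 : ℝ) < 1 + c ^ 2 := by positivity
  have h : 1 / (1 + b ^ 2) - 1 / (1 + c ^ 2)
      = (b - c) * (-(b + c) / ((1 + b ^ 2) * (1 + c ^ 2))) := by field_simp; ring
  rw [h, abs_mul]
  refine mul_le_of_le_one_right (abs_nonneg _) ?_
  rw [abs_div, abs_of_pos (mul_pos hb hc), div_le_one (mul_pos hb hc), abs_le]
  constructor <;> nlinarith [sq_nonneg (b - 1), sq_nonneg (b + 1), sq_nonneg (c - 1),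
    sq_nonneg (c + 1), sq_nonneg (b * c)]

lemma abs_arctan_le (b : ℝ) : |Real.arctan b| ≤ Real.pi / 2 :=
  abs_le.2 ⟨(Real.neg_pi_div_two_lt_arctan b).le, (Real.arctan_lt_pi_div_two b).le⟩

/-- The offset `2π` in `Φ` dominates `4|arctan b|`. Monotonicity in the first slot means that the
successor of a coordinate can only make its partial derivative more negative. -/
lemma linkFst_nonpos (a b : ℝ) : linkFst a b ≤ 0 := by
  have h1 : |evenPsi' a * Real.arctan b| ≤ |evenPsi' a| * (Real.pi / 2) := by
    rw [abs_mul]; exact mul_le_mul_of_nonneg_left (abs_arctan_le b) (abs_nonneg _)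
  have := (abs_le.1 h1).1
  unfold linkFst; linarith

lemma linkSnd_nonpos (a b : ℝ) : linkSnd a b ≤ 0 := by
  have := mul_nonneg (evenPsi_nonneg a) (one_div_one_add_sq_pos b).le
  unfold linkSnd; linarith

/-- This and `linkSnd_zero` are the dead zone behind the propagation delay: a zero coordinate is not
moved by its successor, nor any coordinate by a zero predecessor. -/
lemma linkFst_zero (b : ℝ) : linkFst 0 b = 0 := by simp [linkFst, evenPsi'_zero]

lemma linkSnd_zero (b : ℝ) : linkSnd 0 b = 0 := by simp [linkSnd, evenPsi_zero]

/-- Both factors `evenPsi a` and `1 / (1 + b²)` exceed `1/2`, and the prefactor is `4`. -/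
lemma linkSnd_lt_neg_one {a b : ℝ} (ha : 1 ≤ |a|) (hb : |b| < 1) : linkSnd a b < -1 := by
  have h1 : b ^ 2 < 1 := by rw [← sq_abs]; nlinarith [abs_nonneg b]
  have h2 : 1 / 2 < 1 / (1 + b ^ 2) := by
    apply one_div_lt_one_div_of_lt <;> nlinarith [sq_nonneg b]
  have h3 := half_lt_evenPsi ha
  unfold linkSnd; nlinarith

lemma abs_linkFst_le (a b : ℝ) : |linkFst a b| ≤ 4 * Real.pi := by
  rw [abs_of_nonpos (linkFst_nonpos a b)]
  have h1 : |evenPsi' a * Real.arctan b| ≤ 1 * (Real.pi / 2) := by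
    rw [abs_mul]
    exact mul_le_mul (abs_evenPsi'_le_one a) (abs_arctan_le b) (abs_nonneg _) zero_le_one
  have := (abs_le.1 h1).2
  have h2 := abs_evenPsi'_le_one a
  unfold linkFst; nlinarith [Real.pi_pos]

lemma abs_linkSnd_le (a b : ℝ) : |linkSnd a b| ≤ 4 := by
  rw [abs_of_nonpos (linkSnd_nonpos a b)]
  have := mul_le_one₀ (evenPsi_le_one a) (one_div_one_add_sq_pos b).le (one_div_one_add_sq_le b)
  unfold linkSnd; linarith

lemma abs_linkFst_sub_le (a b a' b' : ℝ) :
    |linkFst a b - linkFst a' b'| ≤ 8 * Real.pi * |a - a'| + 4 * |b - b'| := by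
  have e : linkFst a b - linkFst a' b' = -(2 * Real.pi * (|evenPsi' a| - |evenPsi' a'|))
      - 4 * ((evenPsi' a - evenPsi' a') * Real.arctan b)
      - 4 * (evenPsi' a' * (Real.arctan b - Real.arctan b')) := by unfold linkFst; ring
  have h1 := (abs_abs_sub_abs_le_abs_sub (evenPsi' a) (evenPsi' a')).trans
    (abs_evenPsi'_sub_le a a')
  have h2 : |(evenPsi' a - evenPsi' a') * Real.arctan b| ≤ 2 * |a - a'| * (Real.pi / 2) := by
    rw [abs_mul]
    exact mul_le_mul (abs_evenPsi'_sub_le a a') (abs_arctan_le b) (abs_nonneg _) (by positivity)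
  have h3 : |evenPsi' a' * (Real.arctan b - Real.arctan b')| ≤ 1 * |b - b'| := by
    rw [abs_mul]
    exact mul_le_mul (abs_evenPsi'_le_one a') (abs_arctan_sub_le b b') (abs_nonneg _) zero_le_one
  have hp := Real.pi_pos
  rw [e]
  rw [abs_le] at h1 h2 h3 ⊢
  constructor <;> nlinarith

lemma abs_linkSnd_sub_le (a b a' b' : ℝ) :
    |linkSnd a b - linkSnd a' b'| ≤ 4 * |a - a'| + 4 * |b - b'| := by
  have e : linkSnd a b - linkSnd a' b' = -(4 * ((evenPsi a - evenPsi a') * (1 / (1 + b ^ 2))))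
      - 4 * (evenPsi a' * (1 / (1 + b ^ 2) - 1 / (1 + b' ^ 2))) := by unfold linkSnd; ring
  have h2 : |(evenPsi a - evenPsi a') * (1 / (1 + b ^ 2))| ≤ |a - a'| * 1 := by
    rw [abs_mul, abs_of_pos (one_div_one_add_sq_pos b)]
    exact mul_le_mul (abs_evenPsi_sub_le a a') (one_div_one_add_sq_le b)
      (one_div_one_add_sq_pos b).le (by positivity)
  have h3 : |evenPsi a' * (1 / (1 + b ^ 2) - 1 / (1 + b' ^ 2))| ≤ 1 * |b - b'| := by
    rw [abs_mul, abs_of_nonneg (evenPsi_nonneg a')]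
    exact mul_le_mul (evenPsi_le_one a') (abs_one_div_one_add_sq_sub_le b b') (abs_nonneg _)
      zero_le_one
  rw [e]
  rw [abs_le] at h2 h3 ⊢
  constructor <;> nlinarith

lemma neg_four_pi_le_link (a b : ℝ) : -(4 * Real.pi) ≤ link a b := by
  have h1 := (abs_le.1 (abs_oddPsi_le a)).2
  have h2 : evenPsi a * Real.arctan b ≤ 1 * (Real.pi / 2) :=
    (mul_le_mul_of_nonneg_left (le_of_abs_le (abs_arctan_le b)) (evenPsi_nonneg a)).trans
      (mul_le_mul_of_nonneg_right (evenPsi_le_one a) (by positivity))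
  have h3 := evenPsi_le_one a
  unfold link; nlinarith [Real.pi_pos]

lemma link_zero (b : ℝ) : link 0 b = 0 := by simp [link, oddPsi, evenPsi_zero]

/-- With the first slot fixed at `1` the odd part cancels, leaving half of the general bound `4π`.
This is the origin of `d̄ - 1/2` in the gap. -/
lemma link_one_sub_le (b : ℝ) : link 1 0 - link 1 b ≤ 2 * Real.pi := by
  have h2 : evenPsi 1 * Real.arctan b ≤ 1 * (Real.pi / 2) :=
    (mul_le_mul_of_nonneg_left (le_of_abs_le (abs_arctan_le b)) (evenPsi_nonneg 1)).trans
      (mul_le_mul_of_nonneg_right (evenPsi_le_one 1) (by positivity))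
  simp only [link, Real.arctan_zero]; linarith

/-- The chain rule for `link`. -/
lemma HasFDerivAt.link {V : Type*} [NormedAddCommGroup V] [NormedSpace ℝ V] {u v : V → ℝ}
    {u' v' : V →L[ℝ] ℝ} {x : V} (hu : HasFDerivAt u u' x) (hv : HasFDerivAt v v' x) :
    HasFDerivAt (fun y => link (u y) (v y))
      (linkFst (u x) (v x) • u' + linkSnd (u x) (v x) • v') x := by
  have h1 := ((hasDerivAt_oddPsi (u x)).comp_hasFDerivAt x hu).const_mul (2 * Real.pi)
  have h2 := ((hasDerivAt_evenPsi (u x)).comp_hasFDerivAt x hu).const_mul 4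
  have h3 := (Real.hasDerivAt_arctan (v x)).comp_hasFDerivAt x hv
  refine ((h1.neg).sub (h2.mul h3)).congr_fderiv ?_
  ext w
  simp [linkFst, linkSnd]
  ring

/-! ### The smooth part of the hard instance and its gradient -/

/-- The sequence `1, z₁, …, z_d, 0, 0, …`. -/
def ext {d : ℕ} (z : Fin d → ℝ) (j : ℕ) : ℝ := if j = 0 then 1 else coord z j

/-- The weight of `φ(z, j)` in `h_i`. -/
def weight (d N i j : ℕ) : ℝ :=
  if j = 1 then 1 else if j ≤ d ∧ ((i ≤ N ∧ Even j) ∨ (2 * N < i ∧ Odd j)) then 3 else 0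

lemma ext_zero {d : ℕ} (z : Fin d → ℝ) : ext z 0 = 1 := by simp [ext]

lemma ext_succ {d : ℕ} (z : Fin d → ℝ) (k : Fin d) : ext z (k.val + 1) = z k := by
  have : k.val + 1 ≤ d := k.isLt
  simp [ext, coord, this]

lemma ext_of_lt {d : ℕ} (z : Fin d → ℝ) {j : ℕ} (hj : d < j) : ext z j = 0 := by
  have h0 : j ≠ 0 := by omega
  simp [ext, coord, h0]; omega

/-- Padding with `1` in slot zero makes `φ(z, 1)` a link like the others, since `Ψ(-1) = 0`;
otherwise only the oddness of `arctan` is needed. -/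
lemma varphi_eq_link {d : ℕ} (z : Fin d → ℝ) (j : ℕ) :
    varphi z (j + 1) = link (ext z j) (ext z (j + 1)) := by
  rcases Nat.eq_zero_or_pos j with rfl | h
  · have h2 : Psi (-1) = 0 := Psi_of_nonpos (by norm_num)
    simp [varphi, ext, link, oddPsi, Phi, evenPsi_eq, h2]
    ring
  · have h0 : j ≠ 0 := by omega
    simp only [varphi, ext, link, oddPsi, Phi, h0, evenPsi_eq, Real.arctan_neg]
    simp [h0]; ring

lemma add_three_mul_sum_even (F : ℕ → ℝ) (n : ℕ) :
    F 1 + 3 * ∑ j ∈ Finset.Icc 1 n, F (2 * j) = ∑ j ∈ Finset.range (2 * n + 1),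
      (if j = 0 then 1 else if Odd j then 3 else 0) * F (j + 1) := by
  induction n with
  | zero => simp
  | succ n ih =>
    rw [Finset.sum_Icc_succ_top (by omega), show 2 * (n + 1) + 1 = 2 * n + 1 + 1 + 1 by ring,
      Finset.sum_range_succ, Finset.sum_range_succ, ← ih]
    have h1 : Odd (2 * n + 1) := ⟨n, rfl⟩
    have h2 : ¬ Odd (2 * n + 1 + 1) := by simp [Nat.odd_add_one, h1]
    simp only [h1, h2, if_true, if_false]
    simp; ring_nf

lemma add_three_mul_sum_odd (F : ℕ → ℝ) (n : ℕ) :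
    F 1 + 3 * ∑ j ∈ Finset.Icc 1 n, F (2 * j + 1) = ∑ j ∈ Finset.range (2 * n + 1),
      (if j = 0 then 1 else if Even j then 3 else 0) * F (j + 1) := by
  induction n with
  | zero => simp
  | succ n ih =>
    rw [Finset.sum_Icc_succ_top (by omega), show 2 * (n + 1) + 1 = 2 * n + 1 + 1 + 1 by ring,
      Finset.sum_range_succ, Finset.sum_range_succ, ← ih]
    have h1 : ¬ Even (2 * n + 1) := by simp
    have h2 : Even (2 * n + 1 + 1) := by simp [Nat.even_add_one]
    simp only [h1, h2, if_true, if_false]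
    simp; ring_nf

/-- For odd `d = 2n + 1` the indices `2j` and `2j + 1` with `j ≤ n` stay within `1, …, d`, so each
`h_i` is one weighted sum over the same links. -/
lemma h_eq_sum {d : ℕ} (hd : Odd d) (N i : ℕ) (z : Fin d → ℝ) :
    h N i z = ∑ k : Fin d, weight d N i (k.val + 1) * link (ext z k.val) (z k) := by
  obtain ⟨n, rfl⟩ := hd
  have hn : (2 * n + 1) / 2 = n := by omega
  have key : ∑ k : Fin (2 * n + 1), weight (2 * n + 1) N i (k.val + 1) * link (ext z k.val) (z k)
      = ∑ j ∈ Finset.range (2 * n + 1), weight (2 * n + 1) N i (j + 1) * varphi z (j + 1) := by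
    rw [← Fin.sum_univ_eq_sum_range
      (fun j => weight (2 * n + 1) N i (j + 1) * varphi z (j + 1))]
    exact Finset.sum_congr rfl fun k _ => by rw [varphi_eq_link, ext_succ]
  rw [key, h, hn]
  split_ifs with h1 h2
  · rw [add_three_mul_sum_even]
    refine Finset.sum_congr rfl fun j hj => ?_
    have hj' : j + 1 ≤ 2 * n + 1 := Finset.mem_range.1 hj
    have h3 : ¬ 2 * N < i := by omega
    simp [weight, h1, h3, hj', Nat.even_add_one]
  · rw [Finset.sum_eq_single 0]
    · simp [weight]
    · intro j _ hj0
      have h3 : ¬ 2 * N < i := by omega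
      simp [weight, h1, h3, hj0]
    · simp
  · rw [add_three_mul_sum_odd]
    refine Finset.sum_congr rfl fun j hj => ?_
    have hj' : j + 1 ≤ 2 * n + 1 := Finset.mem_range.1 hj
    have h3 : 2 * N < i := by omega
    simp [weight, h1, h3, hj', Nat.odd_add_one]

/-- The amplitude of the components `f_i`. -/
def amp (ε L : ℝ) (N : ℕ) : ℝ := 300 * Real.pi * ε ^ 2 / (((3 * N : ℕ) : ℝ) * L)

/-- The scaling of the argument in the components `f_i`. -/
def scale (ε L : ℝ) (N : ℕ) : ℝ := Real.sqrt ((3 * N : ℕ) : ℝ) * L / (150 * Real.pi * ε)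

/-- The `i`-th block of `x`, scaled by `s`. -/
def block {m d : ℕ} (s : ℝ) (x : EuclideanSpace ℝ (Fin m × Fin d)) (i : Fin m) : Fin d → ℝ :=
  fun j => s * x (i, j)

lemma hardInstance_f₀ (ε L : ℝ) (m₁ m₂ : ℕ) {dbar : ℕ} (hd : Odd dbar) (β : ℝ) :
    (hardInstance ε L m₁ m₂ dbar β).f₀ = fun x => ∑ i : Fin (3 * m₁ * m₂),
      amp ε L (m₁ * m₂) * ∑ k : Fin dbar, weight dbar (m₁ * m₂) (i.val + 1) (k.val + 1) *
        link (ext (block (scale ε L (m₁ * m₂)) x i) k.val)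
          (block (scale ε L (m₁ * m₂)) x i k) := by
  funext x
  simp only [hardInstance, fComp]
  refine Finset.sum_congr rfl fun i _ => ?_
  rw [h_eq_sum hd]
  have : (fun j => Real.sqrt ((3 * (m₁ * m₂) : ℕ) : ℝ) * L * x (i, j) / (150 * Real.pi * ε))
      = block (scale ε L (m₁ * m₂)) x i := by
    funext j; simp only [block, scale]; ring
  simp only [congrFun this, amp]

/-- The `k`-th partial derivative of `h_i`. -/
def partialH {d : ℕ} (N i : ℕ) (z : Fin d → ℝ) (k : Fin d) : ℝ :=
  weight d N i (k.val + 1) * linkSnd (ext z k.val) (z k) +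
    weight d N i (k.val + 2) * linkFst (z k) (ext z (k.val + 2))

lemma hasFDerivAt_block {m d : ℕ} (s : ℝ) (x : EuclideanSpace ℝ (Fin m × Fin d)) (i : Fin m)
    (k : Fin d) : HasFDerivAt (fun y => block s y i k)
      (s • (EuclideanSpace.proj (i, k) : EuclideanSpace ℝ (Fin m × Fin d) →L[ℝ] ℝ)) x :=
  (EuclideanSpace.proj (i, k) : EuclideanSpace ℝ (Fin m × Fin d) →L[ℝ] ℝ).hasFDerivAt.const_mul s

/-- The derivative of `x ↦ ext (block s x i) k`. -/
def extDeriv {m d : ℕ} (s : ℝ) (i : Fin m) (k : Fin d) :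
    EuclideanSpace ℝ (Fin m × Fin d) →L[ℝ] ℝ :=
  if k.val = 0 then 0 else s • EuclideanSpace.proj (i, (⟨k.val - 1, by omega⟩ : Fin d))

lemma hasFDerivAt_ext_block {m d : ℕ} (s : ℝ) (x : EuclideanSpace ℝ (Fin m × Fin d)) (i : Fin m)
    (k : Fin d) : HasFDerivAt (fun y => ext (block s y i) k.val) (extDeriv s i k) x := by
  unfold extDeriv
  split_ifs with h
  · simp only [h, ext_zero]
    exact hasFDerivAt_const _ _
  · have e : ∀ y : EuclideanSpace ℝ (Fin m × Fin d),
        ext (block s y i) k.val = block s y i ⟨k.val - 1, by omega⟩ := by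
      intro y
      rw [← ext_succ (block s y i)]
      congr 1
      simp; omega
    simp only [e]
    exact hasFDerivAt_block s x i _

lemma proj_single {m d : ℕ} (i i₀ : Fin m) (k k₀ : Fin d) :
    (EuclideanSpace.proj (i, k) : EuclideanSpace ℝ (Fin m × Fin d) →L[ℝ] ℝ)
      (EuclideanSpace.single (i₀, k₀) 1) = if i = i₀ then (if k = k₀ then 1 else 0) else 0 := by
  change (EuclideanSpace.single (i₀, k₀) (1 : ℝ)) (i, k) = _
  simp [Prod.ext_iff, ite_and]

lemma extDeriv_single {m d : ℕ} (s : ℝ) (i i₀ : Fin m) (k k₀ : Fin d) :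
    extDeriv s i k (EuclideanSpace.single (i₀, k₀) 1) =
      if i = i₀ then (if k.val = k₀.val + 1 then s else 0) else 0 := by
  unfold extDeriv
  by_cases h : k.val = 0
  · simp [h]
  · rw [if_neg h, smul_apply, proj_single]
    have : ((⟨k.val - 1, by omega⟩ : Fin d) = k₀) ↔ k.val = k₀.val + 1 := by
      rw [Fin.ext_iff]; simp; omega
    simp only [this]
    split_ifs <;> simp

lemma hasFDerivAt_objective {m d : ℕ} (a s : ℝ) (N : ℕ)
    (x : EuclideanSpace ℝ (Fin m × Fin d)) :
    HasFDerivAt (fun x => ∑ i : Fin m, a * ∑ k : Fin d, weight d N (i.val + 1) (k.val + 1) *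
        link (ext (block s x i) k.val) (block s x i k))
      (∑ i : Fin m, a • ∑ k : Fin d, weight d N (i.val + 1) (k.val + 1) •
        (linkFst (ext (block s x i) k.val) (block s x i k) • extDeriv s i k +
          linkSnd (ext (block s x i) k.val) (block s x i k) •
            s • (EuclideanSpace.proj (i, k) : EuclideanSpace ℝ (Fin m × Fin d) →L[ℝ] ℝ))) x := by
  refine HasFDerivAt.fun_sum fun i _ => HasFDerivAt.const_mul ?_ a
  refine HasFDerivAt.fun_sum fun k _ => HasFDerivAt.const_mul ?_ _
  exact HasFDerivAt.link (hasFDerivAt_ext_block s x i k) (hasFDerivAt_block s x i k)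

lemma gradient_objective {m d : ℕ} (a s : ℝ) (N : ℕ)
    (x : EuclideanSpace ℝ (Fin m × Fin d)) (i : Fin m) (k : Fin d) :
    gradient (fun x : EuclideanSpace ℝ (Fin m × Fin d) =>
        ∑ i : Fin m, a * ∑ k : Fin d, weight d N (i.val + 1) (k.val + 1) *
        link (ext (block s x i) k.val) (block s x i k)) x (i, k)
      = a * s * partialH N (i.val + 1) (block s x i) k := by
  set f := (fun x : EuclideanSpace ℝ (Fin m × Fin d) =>
        ∑ i : Fin m, a * ∑ k : Fin d, weight d N (i.val + 1) (k.val + 1) *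
        link (ext (block s x i) k.val) (block s x i k)) with hf
  have h1 : gradient f x (i, k) = fderiv ℝ f x (EuclideanSpace.single (i, k) 1) := by
    have : ⟪gradient f x, EuclideanSpace.single (i, k) (1 : ℝ)⟫_ℝ
        = fderiv ℝ f x (EuclideanSpace.single (i, k) 1) := by
      rw [gradient, InnerProductSpace.toDual_symm_apply]
    rw [← this, EuclideanSpace.inner_single_right]
    simp
  rw [h1, hf, (hasFDerivAt_objective a s N x).fderiv]
  simp only [sum_apply, smul_apply, add_apply, extDeriv_single, proj_single, smul_eq_mul]
  rw [Finset.sum_eq_single i, mul_assoc]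
  · congr 1
    simp only [mul_add, Finset.sum_add_distrib, if_true]
    rw [add_comm, partialH, mul_add]
    congr 1
    · rw [Finset.sum_eq_single k]
      · simp; ring
      · intro b _ hb
        simp [hb]
      · simp
    · by_cases hk : k.val + 1 < d
      · rw [Finset.sum_eq_single ⟨k.val + 1, hk⟩]
        · rw [ext_succ, ← ext_succ (block s x i) (⟨k.val + 1, hk⟩ : Fin d)]
          simp; ring
        · intro b _ hb
          have : b.val ≠ k.val + 1 := fun h => hb (Fin.ext h)
          simp [this]
        · simp
      -- The last coordinate has no successor: the guard `j ≤ d` in `weight` removes the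
      -- out-of-range term of `partialH`.
      · have hw : weight d N (i.val + 1) (k.val + 2) = 0 := by
          simp [weight]; omega
        rw [hw, zero_mul, mul_zero]
        refine Finset.sum_eq_zero fun b _ => ?_
        have : b.val ≠ k.val + 1 := by omega
        simp [this]
  · intro b _ hb
    simp [hb]
  · simp

/-! ### Smoothness and lower boundedness of the smooth part -/

lemma weight_nonneg (d N i j : ℕ) : 0 ≤ weight d N i j := by
  unfold weight; split_ifs <;> norm_num

lemma weight_le (d N i j : ℕ) : weight d N i j ≤ 3 := by
  unfold weight; split_ifs <;> norm_num

lemma abs_weight_mul_le (d N i j : ℕ) {u c : ℝ} (hu : |u| ≤ c) :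
    |weight d N i j * u| ≤ 3 * c := by
  rw [abs_mul, abs_of_nonneg (weight_nonneg _ _ _ _)]
  exact mul_le_mul (weight_le _ _ _ _) hu (abs_nonneg _) (by norm_num)

lemma abs_partialH_le {d : ℕ} (N i : ℕ) (z : Fin d → ℝ) (k : Fin d) :
    |partialH N i z k| ≤ 25 * Real.pi := by
  have h1 := abs_weight_mul_le d N i (k.val + 1) (abs_linkSnd_le (ext z k.val) (z k))
  have h2 := abs_weight_mul_le d N i (k.val + 2) (abs_linkFst_le (z k) (ext z (k.val + 2)))
  have h3 := Real.pi_gt_three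
  exact (abs_add_le _ _).trans (by linarith)

lemma abs_partialH_sub_le {d : ℕ} (N i : ℕ) (z z' : Fin d → ℝ) (k : Fin d) :
    |partialH N i z k - partialH N i z' k| ≤ (24 * Real.pi + 12) * |z k - z' k| +
      12 * |ext z k.val - ext z' k.val| + 12 * |ext z (k.val + 2) - ext z' (k.val + 2)| := by
  have h1 := abs_weight_mul_le d N i (k.val + 1)
    (abs_linkSnd_sub_le (ext z k.val) (z k) (ext z' k.val) (z' k))
  have h2 := abs_weight_mul_le d N i (k.val + 2)
    (abs_linkFst_sub_le (z k) (ext z (k.val + 2)) (z' k) (ext z' (k.val + 2)))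
  have e : partialH N i z k - partialH N i z' k =
      weight d N i (k.val + 1) * (linkSnd (ext z k.val) (z k) - linkSnd (ext z' k.val) (z' k)) +
      weight d N i (k.val + 2) *
        (linkFst (z k) (ext z (k.val + 2)) - linkFst (z' k) (ext z' (k.val + 2))) := by
    unfold partialH; ring
  rw [e]
  exact (abs_add_le _ _).trans (by linarith)

lemma abs_ext_sub_le {d : ℕ} {z z' : Fin d → ℝ} {δ : ℝ} (hδ : 0 ≤ δ)
    (h : ∀ k, |z k - z' k| ≤ δ) (j : ℕ) : |ext z j - ext z' j| ≤ δ := by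
  rcases j with _ | j
  · simpa [ext_zero] using hδ
  · by_cases hj : j < d
    · have := h ⟨j, hj⟩
      rwa [← ext_succ z, ← ext_succ z'] at this
    · rw [ext_of_lt z (by omega), ext_of_lt z' (by omega)]; simpa using hδ

lemma abs_partialH_sub_le_of_forall {d : ℕ} (N i : ℕ) {z z' : Fin d → ℝ} {δ : ℝ} (hδ : 0 ≤ δ)
    (h : ∀ k, |z k - z' k| ≤ δ) (k : Fin d) :
    |partialH N i z k - partialH N i z' k| ≤ 75 * Real.pi * δ := by
  have h0 := abs_partialH_sub_le N i z z' k
  have h1 := abs_ext_sub_le hδ h k.val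
  have h2 := abs_ext_sub_le hδ h (k.val + 2)
  have h3 := h k
  have h4 := Real.pi_gt_three
  nlinarith

lemma sum_ext_sub_sq_le {d : ℕ} (z z' : Fin d → ℝ) :
    ∑ k : Fin d, (ext z k.val - ext z' k.val) ^ 2 ≤ ∑ k, (z k - z' k) ^ 2 := by
  have e : ∑ k, (z k - z' k) ^ 2
      = ∑ k ∈ Finset.range d, (ext z (k + 1) - ext z' (k + 1)) ^ 2 := by
    rw [← Fin.sum_univ_eq_sum_range (fun k => (ext z (k + 1) - ext z' (k + 1)) ^ 2)]
    exact Finset.sum_congr rfl fun k _ => by rw [ext_succ, ext_succ]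
  rw [e, Fin.sum_univ_eq_sum_range (fun k => (ext z k - ext z' k) ^ 2)]
  have h1 := Finset.sum_range_succ (fun k => (ext z k - ext z' k) ^ 2) d
  rw [Finset.sum_range_succ', ext_zero, ext_zero] at h1
  nlinarith [sq_nonneg (ext z d - ext z' d)]

lemma sum_ext_add_two_sub_sq_le {d : ℕ} (z z' : Fin d → ℝ) :
    ∑ k : Fin d, (ext z (k.val + 2) - ext z' (k.val + 2)) ^ 2 ≤ ∑ k, (z k - z' k) ^ 2 := by
  have e : ∑ k, (z k - z' k) ^ 2
      = ∑ k ∈ Finset.range d, (ext z (k + 1) - ext z' (k + 1)) ^ 2 := by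
    rw [← Fin.sum_univ_eq_sum_range (fun k => (ext z (k + 1) - ext z' (k + 1)) ^ 2)]
    exact Finset.sum_congr rfl fun k _ => by rw [ext_succ, ext_succ]
  rw [e, Fin.sum_univ_eq_sum_range (fun k => (ext z (k + 2) - ext z' (k + 2)) ^ 2)]
  have h1 := Finset.sum_range_succ (fun k => (ext z (k + 1) - ext z' (k + 1)) ^ 2) d
  rw [Finset.sum_range_succ', ext_of_lt z (Nat.lt_succ_self d),
    ext_of_lt z' (Nat.lt_succ_self d)] at h1
  nlinarith [sq_nonneg (ext z (0 + 1) - ext z' (0 + 1))]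

/-- A Schur test for a three-band matrix with entries `α, 12, 12`: Cauchy–Schwarz bounds each row
with total weight `α + 24`, and since shifting does not increase the `ℓ²` norm, the sum over rows
costs another `α + 24 = 24π + 36 ≤ 75π`. -/
lemma sum_partialH_sub_sq_le {d : ℕ} (N i : ℕ) (z z' : Fin d → ℝ) :
    ∑ k, (partialH N i z k - partialH N i z' k) ^ 2
      ≤ (75 * Real.pi) ^ 2 * ∑ k, (z k - z' k) ^ 2 := by
  have hp := Real.pi_gt_three
  set α := 24 * Real.pi + 12 with hα
  have h1 : ∀ k, (partialH N i z k - partialH N i z' k) ^ 2 ≤ (α + 24) *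
      (α * (z k - z' k) ^ 2 + 12 * (ext z k.val - ext z' k.val) ^ 2 +
        12 * (ext z (k.val + 2) - ext z' (k.val + 2)) ^ 2) := by
    intro k
    have h := abs_partialH_sub_le N i z z' k
    rw [← hα] at h
    rw [← sq_abs, ← sq_abs (z k - z' k), ← sq_abs (ext z k.val - ext z' k.val),
      ← sq_abs (ext z (k.val + 2) - ext z' (k.val + 2))]
    refine (pow_le_pow_left₀ (abs_nonneg _) h 2).trans ?_
    generalize |z k - z' k| = u
    generalize |ext z k.val - ext z' k.val| = v
    generalize |ext z (k.val + 2) - ext z' (k.val + 2)| = w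
    have hα0 : 0 ≤ α := by rw [hα]; linarith
    nlinarith [mul_nonneg hα0 (sq_nonneg (u - v)), mul_nonneg hα0 (sq_nonneg (u - w)),
      sq_nonneg (v - w)]
  refine (Finset.sum_le_sum fun k _ => h1 k).trans ?_
  rw [← Finset.mul_sum, Finset.sum_add_distrib, Finset.sum_add_distrib, ← Finset.mul_sum,
    ← Finset.mul_sum, ← Finset.mul_sum]
  have h2 := sum_ext_sub_sq_le z z'
  have h3 := sum_ext_add_two_sub_sq_le z z'
  have h4 : 0 ≤ ∑ k, (z k - z' k) ^ 2 := Finset.sum_nonneg fun k _ => sq_nonneg _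
  have h5 : 0 ≤ α + 24 := by rw [hα]; linarith
  have h6 : α + 24 ≤ 75 * Real.pi := by rw [hα]; linarith
  calc _ ≤ (α + 24) * ((α + 24) * ∑ k, (z k - z' k) ^ 2) := by
        apply mul_le_mul_of_nonneg_left _ h5; linarith
    _ = (α + 24) ^ 2 * ∑ k, (z k - z' k) ^ 2 := by ring
    _ ≤ _ := mul_le_mul_of_nonneg_right (pow_le_pow_left₀ h5 h6 2) h4

/-- The factor between partial derivatives of `h_i` and of `f_i`. It is tuned so that `m` partial
derivatives averaging below `-1/2` sum to less than `-ε√m`. -/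
lemma amp_mul_scale {ε L : ℝ} (hε : 0 < ε) (hL : 0 < L) {N : ℕ} (hN : 0 < N) :
    amp ε L N * scale ε L N = 2 * ε / Real.sqrt ((3 * N : ℕ) : ℝ) := by
  have hm : (0 : ℝ) < ((3 * N : ℕ) : ℝ) := by exact_mod_cast (by omega : 0 < 3 * N)
  have hp := Real.pi_pos
  have hs := Real.sqrt_pos.2 hm
  have h2 := Real.mul_self_sqrt hm.le
  unfold amp scale
  generalize ((3 * N : ℕ) : ℝ) = m at *
  rw [← h2]
  have : Real.sqrt (Real.sqrt m * Real.sqrt m) = Real.sqrt m := by rw [h2]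
  rw [this]
  field_simp
  ring

/-- The normalization that turns the Lipschitz constant `75π` of the gradient of `h_i` into exactly
`L`. -/
lemma amp_mul_scale_sq {ε L : ℝ} (hε : 0 < ε) (hL : 0 < L) {N : ℕ} (hN : 0 < N) :
    amp ε L N * scale ε L N * scale ε L N * (75 * Real.pi) = L := by
  have hm : (0 : ℝ) < ((3 * N : ℕ) : ℝ) := by exact_mod_cast (by omega : 0 < 3 * N)
  have hp := Real.pi_pos
  have hs := Real.sqrt_pos.2 hm
  rw [amp_mul_scale hε hL hN, scale]
  field_simp
  norm_num

lemma scale_pos {ε L : ℝ} (hε : 0 < ε) (hL : 0 < L) {N : ℕ} (hN : 0 < N) : 0 < scale ε L N := by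
  have hm : (0 : ℝ) < ((3 * N : ℕ) : ℝ) := by exact_mod_cast (by omega : 0 < 3 * N)
  have hp := Real.pi_pos
  have hs := Real.sqrt_pos.2 hm
  unfold scale; positivity

lemma amp_pos {ε L : ℝ} (hε : 0 < ε) (hL : 0 < L) {N : ℕ} (hN : 0 < N) : 0 < amp ε L N := by
  have hm : (0 : ℝ) < ((3 * N : ℕ) : ℝ) := by exact_mod_cast (by omega : 0 < 3 * N)
  have hp := Real.pi_pos
  unfold amp; positivity

/-- For `j ≥ 2` the factor `3` compensates for only a third of the blocks carrying the link; for `j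
= 1` every block carries it once. In total each link counts `m` times. -/
lemma sum_weight {m N : ℕ} (hm : m = 3 * N) {d j : ℕ} (hd : j ≤ d) :
    ∑ i : Fin m, weight d N (i.val + 1) j = m := by
  subst hm
  rw [Fin.sum_univ_eq_sum_range (fun i => weight d N (i + 1) j)]
  unfold weight
  by_cases hj : j = 1
  · simp [hj]
  · simp only [hj, hd, if_false, true_and]
    rw [← Finset.sum_filter, Finset.sum_const]
    suffices h : (Finset.filter (fun i => i + 1 ≤ N ∧ Even j ∨ 2 * N < i + 1 ∧ Odd j)
        (Finset.range (3 * N))).card = N by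
      rw [h]; push_cast; simp; ring
    rcases Nat.even_or_odd j with he | ho
    · have : Finset.filter (fun i => i + 1 ≤ N ∧ Even j ∨ 2 * N < i + 1 ∧ Odd j)
        (Finset.range (3 * N)) = Finset.range N := by
        ext i
        have : ¬ Odd j := Nat.not_odd_iff_even.2 he
        simp [he, this]; omega
      rw [this, Finset.card_range]
    · have : Finset.filter (fun i => i + 1 ≤ N ∧ Even j ∨ 2 * N < i + 1 ∧ Odd j)
        (Finset.range (3 * N)) = Finset.Ico (2 * N) (3 * N) := by
        ext i
        have : ¬ Even j := Nat.not_even_iff_odd.2 ho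
        simp [ho, this]; omega
      rw [this, Nat.card_Ico]; omega

section Instance

variable {ε L : ℝ} {m₁ m₂ dbar : ℕ} {β : ℝ}

lemma three_mul_eq (m₁ m₂ : ℕ) : 3 * m₁ * m₂ = 3 * (m₁ * m₂) := by ring

lemma gradient_f₀ (hd : Odd dbar) (x : EuclideanSpace ℝ (Fin (3 * m₁ * m₂) × Fin dbar))
    (i : Fin (3 * m₁ * m₂)) (k : Fin dbar) :
    gradient (hardInstance ε L m₁ m₂ dbar β).f₀ x (i, k) =
      amp ε L (m₁ * m₂) * scale ε L (m₁ * m₂) *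
        partialH (m₁ * m₂) (i.val + 1) (block (scale ε L (m₁ * m₂)) x i) k := by
  rw [hardInstance_f₀ ε L m₁ m₂ hd β, gradient_objective]

lemma differentiable_f₀ (hd : Odd dbar) :
    Differentiable ℝ (hardInstance ε L m₁ m₂ dbar β).f₀ := by
  rw [hardInstance_f₀ ε L m₁ m₂ hd β]
  exact fun x => (hasFDerivAt_objective _ _ _ x).differentiableAt

lemma norm_gradient_f₀_sub_le (hε : 0 < ε) (hL : 0 < L) (hN : 0 < m₁ * m₂) (hd : Odd dbar)
    (x x' : EuclideanSpace ℝ (Fin (3 * m₁ * m₂) × Fin dbar)) :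
    ‖gradient (hardInstance ε L m₁ m₂ dbar β).f₀ x
      - gradient (hardInstance ε L m₁ m₂ dbar β).f₀ x'‖ ≤ L * ‖x - x'‖ := by
  have hc := amp_mul_scale_sq hε hL hN
  set c := amp ε L (m₁ * m₂) * scale ε L (m₁ * m₂) with hcdef
  set s := scale ε L (m₁ * m₂) with hs
  refine le_of_sq_le_sq ?_ (by positivity)
  rw [mul_pow, EuclideanSpace.norm_sq_eq, EuclideanSpace.norm_sq_eq, Fintype.sum_prod_type,
    Fintype.sum_prod_type, Finset.mul_sum]
  refine Finset.sum_le_sum fun i _ => ?_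
  have h1 := sum_partialH_sub_sq_le (m₁ * m₂) (i.val + 1) (block s x i) (block s x' i)
  have e1 : ∀ k, ‖(gradient (hardInstance ε L m₁ m₂ dbar β).f₀ x
      - gradient (hardInstance ε L m₁ m₂ dbar β).f₀ x') (i, k)‖ ^ 2 =
      c ^ 2 * (partialH (m₁ * m₂) (i.val + 1) (block s x i) k
        - partialH (m₁ * m₂) (i.val + 1) (block s x' i) k) ^ 2 := by
    intro k
    rw [PiLp.sub_apply, gradient_f₀ hd, gradient_f₀ hd, ← mul_sub, Real.norm_eq_abs, sq_abs,
      mul_pow]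
  have e2 : ∀ k, (block s x i k - block s x' i k) ^ 2 = s ^ 2 * ‖(x - x') (i, k)‖ ^ 2 := by
    intro k
    rw [PiLp.sub_apply, Real.norm_eq_abs, sq_abs]
    simp only [block]; ring
  simp only [e1, e2, ← Finset.mul_sum] at h1 ⊢
  calc _ ≤ c ^ 2 * ((75 * Real.pi) ^ 2 * (s ^ 2 * ∑ k, ‖(x - x') (i, k)‖ ^ 2)) :=
        mul_le_mul_of_nonneg_left h1 (sq_nonneg _)
    _ = (c * s * (75 * Real.pi)) ^ 2 * ∑ k, ‖(x - x') (i, k)‖ ^ 2 := by ring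
    _ = _ := by rw [hc]

lemma f₀_zero_sub_le (hε : 0 < ε) (hL : 0 < L) (hN : 0 < m₁ * m₂) (hd : Odd dbar)
    (x : EuclideanSpace ℝ (Fin (3 * m₁ * m₂) × Fin dbar)) :
    (hardInstance ε L m₁ m₂ dbar β).f₀ 0 - (hardInstance ε L m₁ m₂ dbar β).f₀ x
      ≤ 1200 * Real.pi ^ 2 * ε ^ 2 * (dbar - 1 / 2) / L := by
  have ha := amp_pos hε hL hN
  rw [hardInstance_f₀ ε L m₁ m₂ hd β]
  dsimp only
  set s := scale ε L (m₁ * m₂) with hs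
  set o : EuclideanSpace ℝ (Fin (3 * m₁ * m₂) × Fin dbar) := 0 with ho
  rw [← Finset.mul_sum, ← Finset.mul_sum, ← mul_sub, ← Finset.sum_sub_distrib]
  have h1 : ∀ i : Fin (3 * m₁ * m₂), ∀ k : Fin dbar,
      link (ext (block s o i) k.val) (block s o i k) - link (ext (block s x i) k.val) (block s x i k)
        ≤ if k.val = 0 then 2 * Real.pi else 4 * Real.pi := by
    intro i k
    have hb : ∀ j, block s o i j = 0 := by
      intro j; simp [block, ho]
    split_ifs with hk
    · rw [hk, ext_zero, ext_zero, hb]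
      exact link_one_sub_le _
    · obtain ⟨j, hj⟩ := Nat.exists_eq_succ_of_ne_zero hk
      have h0 : ext (block s o i) k.val = 0 := by
        rw [hj, ← hb ⟨j, by omega⟩, ← ext_succ (block s o i)]
      rw [h0, link_zero]
      linarith [neg_four_pi_le_link (ext (block s x i) k.val) (block s x i k)]
  have h2 : ∑ i : Fin (3 * m₁ * m₂),
      (∑ k : Fin dbar, weight dbar (m₁ * m₂) (i.val + 1) (k.val + 1) *
          link (ext (block s o i) k.val) (block s o i k) -
        ∑ k : Fin dbar, weight dbar (m₁ * m₂) (i.val + 1) (k.val + 1) *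
          link (ext (block s x i) k.val) (block s x i k))
      ≤ ∑ i : Fin (3 * m₁ * m₂), ∑ k : Fin dbar, weight dbar (m₁ * m₂) (i.val + 1) (k.val + 1) *
          (if k.val = 0 then 2 * Real.pi else 4 * Real.pi) := by
    refine Finset.sum_le_sum fun i _ => ?_
    rw [← Finset.sum_sub_distrib]
    refine Finset.sum_le_sum fun k _ => ?_
    rw [← mul_sub]
    exact mul_le_mul_of_nonneg_left (h1 i k) (weight_nonneg _ _ _ _)
  refine (mul_le_mul_of_nonneg_left h2 ha.le).trans (le_of_eq ?_)
  rw [Finset.sum_comm]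
  have h3 : ∀ k : Fin dbar, ∑ i : Fin (3 * m₁ * m₂),
      weight dbar (m₁ * m₂) (i.val + 1) (k.val + 1) *
        (if k.val = 0 then 2 * Real.pi else 4 * Real.pi)
      = ((3 * (m₁ * m₂) : ℕ) : ℝ) * (if k.val = 0 then 2 * Real.pi else 4 * Real.pi) := by
    intro k
    rw [← Finset.sum_mul, sum_weight (three_mul_eq m₁ m₂) (by omega), three_mul_eq]
  simp only [h3, ← Finset.mul_sum]
  obtain ⟨n, rfl⟩ := hd
  have h4 : ∑ k : Fin (2 * n + 1), (if k.val = 0 then 2 * Real.pi else 4 * Real.pi)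
      = 2 * Real.pi + 2 * n * (4 * Real.pi) := by
    rw [Fin.sum_univ_succ]; simp
  rw [h4, amp]
  have hm : (0 : ℝ) < ((3 * (m₁ * m₂) : ℕ) : ℝ) := by exact_mod_cast (by omega)
  generalize ((3 * (m₁ * m₂) : ℕ) : ℝ) = m at hm
  push_cast
  field_simp
  ring

end Instance

/-! ### The constraint matrices and the regularizer -/

/-- The lower endpoint of the edge `e` of the path on `m` nodes. -/
def lo {m : ℕ} (e : Fin (m - 1)) : Fin m := ⟨e.val, by omega⟩

/-- The upper endpoint of the edge `e` of the path on `m` nodes. -/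
def hi {m : ℕ} (e : Fin (m - 1)) : Fin m := ⟨e.val + 1, by omega⟩

lemma J_eq {m : ℕ} (e : Fin (m - 1)) (i : Fin m) :
    J m e i = (if i = hi e then 1 else 0) - (if i = lo e then 1 else 0) := by
  simp only [J, hi, lo, Fin.ext_iff]
  split_ifs <;> first | omega | simp

lemma blockMatrix_apply {m d : ℕ} (L : ℝ) (S : Finset (Fin (m - 1))) (e : S) (i : Fin m)
    (j k : Fin d) : blockMatrix m d L S (e, j) (i, k) =
      (m : ℝ) * L * (J m e.val i * if j = k then 1 else 0) := by
  simp [blockMatrix, Matrix.one_apply]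

lemma mv_apply {ι ν : Type} [Fintype ι] [DecidableEq ι] [Fintype ν]
    (A : Matrix ν ι ℝ) (x : EuclideanSpace ℝ ι) (r : ν) : mv A x r = ∑ c, A r c * x c := by
  simp [mv, Matrix.mulVec, dotProduct]

lemma mv_blockMatrix {m d : ℕ} (L : ℝ) (S : Finset (Fin (m - 1)))
    (x : EuclideanSpace ℝ (Fin m × Fin d)) (e : S) (j : Fin d) :
    mv (blockMatrix m d L S) x (e, j) = (m : ℝ) * L * (x (hi e.val, j) - x (lo e.val, j)) := by
  rw [mv_apply, Fintype.sum_prod_type]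
  simp only [blockMatrix_apply, J_eq]
  have : ∀ i : Fin m, ∑ k : Fin d, (m : ℝ) * L * (((if i = hi e.val then 1 else 0)
      - (if i = lo e.val then 1 else 0)) * if j = k then 1 else 0) * x (i, k) =
      (m : ℝ) * L * ((if i = hi e.val then x (i, j) else 0)
        - (if i = lo e.val then x (i, j) else 0)) := by
    intro i
    rw [Finset.sum_eq_single j]
    · simp only [if_true]; split_ifs <;> ring
    · intro k _ hk; simp [Ne.symm hk]
    · simp
  simp only [this, ← Finset.mul_sum, Finset.sum_sub_distrib, Finset.sum_ite_eq', Finset.mem_univ,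
    if_true]

lemma mv_transpose_blockMatrix {m d : ℕ} (L : ℝ) (S : Finset (Fin (m - 1)))
    (y : EuclideanSpace ℝ (S × Fin d)) (i : Fin m) (j : Fin d) :
    mv (blockMatrix m d L S).transpose y (i, j) =
      ∑ e : S, (m : ℝ) * L * J m e.val i * y (e, j) := by
  rw [mv_apply, Fintype.sum_prod_type]
  refine Finset.sum_congr rfl fun e _ => ?_
  rw [Finset.sum_eq_single j]
  · simp [Matrix.transpose_apply, blockMatrix_apply]
  · intro k _ hk; simp [Matrix.transpose_apply, blockMatrix_apply, hk]
  · simp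

lemma inner_mv_transpose {ι ν : Type} [Fintype ι] [DecidableEq ι] [Fintype ν] [DecidableEq ν]
    (A : Matrix ν ι ℝ) (y : EuclideanSpace ℝ ν) (x : EuclideanSpace ℝ ι) :
    ⟪mv A.transpose y, x⟫_ℝ = ⟪y, mv A x⟫_ℝ := by
  rw [mv, mv, ← Matrix.conjTranspose_eq_transpose_of_trivial,
    Matrix.toEuclideanLin_conjTranspose_eq_adjoint, LinearMap.adjoint_inner_left]

/-- The total variation `β ∑_{e ∈ S} ‖x_{hi e} - x_{lo e}‖₁`. -/
def edgeVariation {m d : ℕ} (β : ℝ) (S : Finset (Fin (m - 1)))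
    (x : EuclideanSpace ℝ (Fin m × Fin d)) : ℝ :=
  β * ∑ e ∈ S, ∑ j, |x (hi e, j) - x (lo e, j)|

lemma properLscConvex_coe {E : Type*} [NormedAddCommGroup E] [InnerProductSpace ℝ E]
    {f : E → ℝ} (hc : Continuous f) (hf : ConvexOn ℝ Set.univ f) :
    ProperLscConvex (fun x => (f x : EReal)) where
  ne_bot x := EReal.coe_ne_bot _
  ne_top := ⟨0, EReal.coe_ne_top _⟩
  lsc := (continuous_coe_real_ereal.comp hc).lowerSemicontinuous
  convex := by simpa using hf.convex_epigraph

lemma convexOn_mul_sum_abs {ι : Type} [Fintype ι] {c : ℝ} (hc : 0 ≤ c) :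
    ConvexOn ℝ Set.univ (fun y : EuclideanSpace ℝ ι => c * ∑ k, |y k|) := by
  refine ⟨convex_univ, fun x _ y _ a b ha hb _ => ?_⟩
  simp only [smul_eq_mul, PiLp.add_apply, PiLp.smul_apply]
  have : ∑ k, |a * x k + b * y k| ≤ a * ∑ k, |x k| + b * ∑ k, |y k| := by
    rw [Finset.mul_sum, Finset.mul_sum, ← Finset.sum_add_distrib]
    refine Finset.sum_le_sum fun k _ => (abs_add_le _ _).trans ?_
    rw [abs_mul, abs_mul, abs_of_nonneg ha, abs_of_nonneg hb]
  nlinarith [mul_le_mul_of_nonneg_left this hc]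

lemma continuous_mul_sum_abs {ι : Type} [Fintype ι] (c : ℝ) :
    Continuous (fun y : EuclideanSpace ℝ ι => c * ∑ k, |y k|) := by
  fun_prop

section Instance

variable {ε L : ℝ} {m₁ m₂ dbar : ℕ} {β : ℝ}

lemma hardInstance_g (hL : 0 < L) (hN : 0 < m₁ * m₂)
    (x : EuclideanSpace ℝ (Fin (3 * m₁ * m₂) × Fin dbar)) :
    (hardInstance ε L m₁ m₂ dbar β).g x = ((edgeVariation β (setM m₁ m₂) x : ℝ) : EReal) := by
  have hm : (0 : ℝ) < ((3 * m₁ * m₂ : ℕ) : ℝ) := by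
    rw [three_mul_eq]; exact_mod_cast (by omega : 0 < 3 * (m₁ * m₂))
  simp only [Problem.g, hardInstance, add_zero]
  congr 1
  rw [Fintype.sum_prod_type]
  simp only [mv_blockMatrix, abs_mul, ← Finset.mul_sum]
  rw [edgeVariation, Finset.sum_coe_sort (setM m₁ m₂)
    (fun e => ∑ j, |x (hi e, j) - x (lo e, j)|), abs_of_pos hm, abs_of_pos hL]
  field_simp

lemma hardInstance_F₀ (hL : 0 < L) (hN : 0 < m₁ * m₂)
    (x : EuclideanSpace ℝ (Fin (3 * m₁ * m₂) × Fin dbar)) :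
    (hardInstance ε L m₁ m₂ dbar β).F₀ x =
      (((hardInstance ε L m₁ m₂ dbar β).f₀ x + edgeVariation β (setM m₁ m₂) x : ℝ) : EReal) := by
  rw [Problem.F₀, hardInstance_g hL hN, EReal.coe_add]

lemma edgeVariation_nonneg {m d : ℕ} (hβ : 0 ≤ β) (S : Finset (Fin (m - 1)))
    (x : EuclideanSpace ℝ (Fin m × Fin d)) : 0 ≤ edgeVariation β S x :=
  mul_nonneg hβ (Finset.sum_nonneg fun _ _ => Finset.sum_nonneg fun _ _ => abs_nonneg _)

lemma edgeVariation_zero {m d : ℕ} (S : Finset (Fin (m - 1))) :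
    edgeVariation β S (0 : EuclideanSpace ℝ (Fin m × Fin d)) = 0 := by
  simp [edgeVariation]

/-! ### Lower bound on the objective, initial gap and class membership. -/

lemma le_iInf_F₀ (hε : 0 < ε) (hL : 0 < L) (hN : 0 < m₁ * m₂) (hd : Odd dbar) (hβ : 0 ≤ β) :
    (((hardInstance ε L m₁ m₂ dbar β).f₀ 0
        - 1200 * Real.pi ^ 2 * ε ^ 2 * (dbar - 1 / 2) / L : ℝ) : EReal)
      ≤ ⨅ x, (hardInstance ε L m₁ m₂ dbar β).F₀ x := by
  refine le_iInf fun x => ?_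
  rw [hardInstance_F₀ hL hN, EReal.coe_le_coe_iff]
  have h1 := f₀_zero_sub_le (β := β) hε hL hN hd x
  have h2 := edgeVariation_nonneg hβ (setM m₁ m₂) x
  linarith

lemma gap_le (hε : 0 < ε) (hL : 0 < L) (hN : 0 < m₁ * m₂) (hd : Odd dbar) (hβ : 0 ≤ β) :
    (hardInstance ε L m₁ m₂ dbar β).gap 0
      ≤ 1200 * Real.pi ^ 2 * ε ^ 2 * (dbar - 1 / 2) / L := by
  have h1 := le_iInf_F₀ (β := β) hε hL hN hd hβ
  have h2 : ⨅ x, (hardInstance ε L m₁ m₂ dbar β).F₀ x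
      ≤ (hardInstance ε L m₁ m₂ dbar β).F₀ 0 := iInf_le _ 0
  rw [Problem.gap]
  rw [hardInstance_F₀ hL hN, edgeVariation_zero, add_zero] at h2 ⊢
  -- The infimum lies between two real numbers, hence is finite, and `toReal` does not fall back on
  -- its default value.
  generalize (⨅ x, (hardInstance ε L m₁ m₂ dbar β).F₀ x) = I at h1 h2
  induction I using EReal.rec with
  | bot => exact absurd (le_bot_iff.1 h1) (EReal.coe_ne_bot _)
  | top => exact absurd h2 (by simp)
  | coe r =>
    rw [← EReal.coe_sub, EReal.toReal_coe]
    rw [EReal.coe_le_coe_iff] at h1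
    linarith

lemma mem_setM (e : Fin (3 * m₁ * m₂ - 1)) :
    e ∈ setM m₁ m₂ ↔ m₁ ∣ e.val + 1 := by
  simp only [setM, Finset.mem_filter, Finset.mem_univ, true_and, Finset.mem_image, Finset.mem_Icc]
  constructor
  · rintro ⟨k, -, hk⟩
    exact ⟨k, by rw [← hk, mul_comm]⟩
  · rintro ⟨k, hk⟩
    refine ⟨k, ⟨?_, ?_⟩, by rw [hk, mul_comm]⟩
    · rcases Nat.eq_zero_or_pos k with rfl | h
      · simp at hk
      · exact h
    · have h1 : m₁ * k < m₁ * (3 * m₂) := by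
        have := e.isLt
        rw [← hk]
        calc e.val + 1 < 3 * m₁ * m₂ := by omega
          _ = _ := by ring
      have := Nat.lt_of_mul_lt_mul_left h1
      omega

lemma beta_nonneg (hε : 0 < ε) (h : Admissible ε L m₁ m₂ dbar β) : 0 ≤ β := by
  refine le_trans ?_ h.beta_gt.le
  have : 0 ≤ specNorm (hardInstance ε L m₁ m₂ dbar β).A := norm_nonneg _
  have := Real.pi_pos
  positivity

lemma Admissible.mul_pos (h : Admissible ε L m₁ m₂ dbar β) : 0 < m₁ * m₂ :=
  Nat.mul_pos (by have := h.two_le; omega) h.one_le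

lemma hardInstance_inClass (hε : 0 < ε) (hL : 0 < L) (h : Admissible ε L m₁ m₂ dbar β) :
    (hardInstance ε L m₁ m₂ dbar β).InClass L := by
  have hN := h.mul_pos
  have hβ := beta_nonneg hε h
  have hc : 0 ≤ β / (((3 * m₁ * m₂ : ℕ) : ℝ) * L) := by positivity
  have hdom : dom (hardInstance ε L m₁ m₂ dbar β).gbar = Set.univ :=
    Set.eq_univ_of_forall fun y => EReal.coe_ne_top _
  refine ⟨(EReal.bot_lt_coe _).trans_le (le_iInf_F₀ hε hL hN h.odd hβ), differentiable_f₀ h.odd,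
    norm_gradient_f₀_sub_le hε hL hN h.odd, ?_, ?_, ?_, ?_⟩
  · have e : (hardInstance ε L m₁ m₂ dbar β).g = fun x =>
        ((((fun y : EuclideanSpace ℝ (setM m₁ m₂ × Fin dbar) =>
          β / (((3 * m₁ * m₂ : ℕ) : ℝ) * L) * ∑ k, |y k|) ∘
          (hardInstance ε L m₁ m₂ dbar β).Abar.toEuclideanLin) x : ℝ) : EReal) := by
      funext x
      simp only [Problem.g, mv, hardInstance, add_zero, Function.comp]
    rw [e]
    refine properLscConvex_coe ((continuous_mul_sum_abs _).comp ?_) ?_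
    · exact LinearMap.continuous_of_finiteDimensional _
    · exact (convexOn_mul_sum_abs hc).comp_linearMap _
  · exact properLscConvex_coe (continuous_mul_sum_abs _) (convexOn_mul_sum_abs hc)
  · rw [hdom]
    exact ⟨0, interior_subset_intrinsicInterior (by simp)⟩
  · rintro ⟨y, hy⟩
    rw [hdom] at hy
    have h1 := h.two_le
    have h2 := h.one_le
    have h5 := h.five_le
    have h3 : m₁ - 1 < 3 * m₁ * m₂ - 1 := by
      have : m₁ * 1 ≤ m₁ * m₂ := Nat.mul_le_mul_left _ h2
      rw [three_mul_eq]; omega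
    -- The edge with one-based number `m₁` shows that the domain space of `ḡ` is nontrivial.
    have h4 : (⟨m₁ - 1, h3⟩ : Fin (3 * m₁ * m₂ - 1)) ∈ setM m₁ m₂ := by
      rw [mem_setM]
      exact ⟨1, by simp; omega⟩
    let k : setM m₁ m₂ × Fin dbar := (⟨_, h4⟩, ⟨0, by omega⟩)
    have e1 : (0 : EuclideanSpace ℝ (setM m₁ m₂ × Fin dbar)) = y := by
      have : (0 : EuclideanSpace ℝ (setM m₁ m₂ × Fin dbar)) ∈ (Set.univ : Set _) := trivial
      rwa [hy] at this
    have e2 : EuclideanSpace.single k (1 : ℝ) = y := by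
      have : EuclideanSpace.single k (1 : ℝ) ∈ (Set.univ : Set _) := trivial
      rwa [hy] at this
    have := congrArg (fun v : EuclideanSpace ℝ (setM m₁ m₂ × Fin dbar) => v k) (e1.trans e2.symm)
    simp at this

lemma exists_admissible (ε L : ℝ) :
    ∃ (m₁ m₂ dbar : ℕ) (β : ℝ), Admissible ε L m₁ m₂ dbar β := by
  refine ⟨2, 1, 5, (50 * Real.pi + 1 + specNorm (hardInstance ε L 2 1 5 0).A) *
    Real.sqrt ((3 * 2 * 1 : ℕ) : ℝ) * ε + 1, le_rfl, le_rfl, by decide, le_rfl, by decide, ?_⟩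
  exact lt_add_one _

end Instance

/-! ### The condition number of the stacked matrix -/

lemma sum_sub_succ_sq_le (V : ℕ → ℝ) (m : ℕ) (h0 : V 0 = 0) (hm : V m = 0) :
    ∑ i ∈ Finset.range m, (V i - V (i + 1)) ^ 2 ≤ 4 * ∑ i ∈ Finset.range m, V i ^ 2 := by
  have h1 : ∑ i ∈ Finset.range m, V (i + 1) ^ 2 = ∑ i ∈ Finset.range m, V i ^ 2 := by
    have := Finset.sum_range_succ (fun i => V i ^ 2) m
    rw [Finset.sum_range_succ', h0, hm] at this
    linarith
  calc ∑ i ∈ Finset.range m, (V i - V (i + 1)) ^ 2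
      ≤ ∑ i ∈ Finset.range m, (2 * V i ^ 2 + 2 * V (i + 1) ^ 2) :=
        Finset.sum_le_sum fun i _ => by nlinarith [sq_nonneg (V i + V (i + 1))]
    _ = _ := by rw [Finset.sum_add_distrib, ← Finset.mul_sum, ← Finset.mul_sum, h1]; ring

/-- A discrete Poincaré inequality: each `V n` telescopes from `V 0 = 0`, and Cauchy–Schwarz costs
one factor `m`; the other comes from summing over `n`. -/
lemma sum_sq_le_mul_sum_sub_succ_sq (V : ℕ → ℝ) (m : ℕ) (h0 : V 0 = 0) :
    ∑ i ∈ Finset.range m, V i ^ 2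
      ≤ (m : ℝ) ^ 2 * ∑ i ∈ Finset.range m, (V i - V (i + 1)) ^ 2 := by
  set Q := ∑ i ∈ Finset.range m, (V i - V (i + 1)) ^ 2 with hQ
  have hQ0 : 0 ≤ Q := Finset.sum_nonneg fun _ _ => sq_nonneg _
  have h1 : ∀ n ∈ Finset.range m, V n ^ 2 ≤ m * Q := by
    intro n hn
    have hn' : n < m := Finset.mem_range.1 hn
    have e : V n = -∑ i ∈ Finset.range n, (V i - V (i + 1)) := by
      rw [Finset.sum_range_sub', h0]; ring
    rw [e, neg_sq]
    have h2 := sq_sum_le_card_mul_sum_sq (s := Finset.range n) (f := fun i => V i - V (i + 1))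
    rw [Finset.card_range] at h2
    have h3 : ∑ i ∈ Finset.range n, (V i - V (i + 1)) ^ 2 ≤ Q :=
      Finset.sum_le_sum_of_subset_of_nonneg (Finset.range_subset_range.2 hn'.le)
        fun _ _ _ => sq_nonneg _
    have h4 : (n : ℝ) ≤ m := by exact_mod_cast hn'.le
    exact h2.trans (mul_le_mul h4 h3 (Finset.sum_nonneg fun _ _ => sq_nonneg _) (by positivity))
  refine (Finset.sum_le_sum h1).trans (le_of_eq ?_)
  rw [Finset.sum_const, Finset.card_range, nsmul_eq_mul]; ring

/-- The value at the edge `e` of a vector indexed by the rows of the stacked matrix. -/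
def unstack {m d : ℕ} (S T : Finset (Fin (m - 1))) (hT : ∀ e, e ∉ S → e ∈ T)
    (v : (S × Fin d) ⊕ (T × Fin d) → ℝ) (j : Fin d) (e : Fin (m - 1)) : ℝ :=
  if h : e ∈ S then v (Sum.inl (⟨e, h⟩, j)) else v (Sum.inr (⟨e, hT e h⟩, j))

/-- The values of `unstack`, shifted by one and extended by zero. -/
def edgeSeq {m : ℕ} (w : Fin (m - 1) → ℝ) (n : ℕ) : ℝ :=
  if h : 0 < n ∧ n < m then w ⟨n - 1, by omega⟩ else 0

/-- An interior block touches the edge before it and the edge after it; the zero values at both ends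
account for the first and last blocks. -/
lemma sum_J_mul {m : ℕ} (w : Fin (m - 1) → ℝ) (i : Fin m) :
    ∑ e, J m e i * w e = edgeSeq w i.val - edgeSeq w (i.val + 1) := by
  simp only [J_eq, sub_mul, Finset.sum_sub_distrib]
  congr 1
  · by_cases h : 0 < i.val
    · rw [Finset.sum_eq_single ⟨i.val - 1, by omega⟩]
      · have : i = hi ⟨i.val - 1, by omega⟩ := by apply Fin.ext; simp [hi]; omega
        rw [if_pos this, edgeSeq, dif_pos ⟨h, i.isLt⟩, one_mul]
      · intro e _ he
        have : ¬ i = hi e := by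
          rintro rfl; apply he; apply Fin.ext; simp [hi]
        simp [this]
      · simp
    · rw [edgeSeq, dif_neg (by tauto)]
      refine Finset.sum_eq_zero fun e _ => ?_
      have : ¬ i = hi e := by rintro rfl; simp [hi] at h
      simp [this]
  · by_cases h : i.val + 1 < m
    · rw [Finset.sum_eq_single ⟨i.val, by omega⟩]
      · have : i = lo ⟨i.val, by omega⟩ := by apply Fin.ext; simp [lo]
        rw [if_pos this, edgeSeq, dif_pos ⟨by omega, h⟩, one_mul]; rfl
      · intro e _ he
        have : ¬ i = lo e := by
          rintro rfl; apply he; apply Fin.ext; simp [lo]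
        simp [this]
      · simp
    · rw [edgeSeq, dif_neg (by tauto)]
      refine Finset.sum_eq_zero fun e _ => ?_
      have : ¬ i = lo e := by rintro rfl; simp [lo] at h; omega
      simp [this]

lemma sum_edgeSeq_sq {m : ℕ} (w : Fin (m - 1) → ℝ) :
    ∑ n ∈ Finset.range m, edgeSeq w n ^ 2 = ∑ e, w e ^ 2 := by
  rcases m with _ | m
  · simp
  · rw [Finset.sum_range_succ', ← Fin.sum_univ_eq_sum_range (fun k => edgeSeq w (k + 1) ^ 2)]
    simp only [edgeSeq]
    simp

lemma sum_unstack {m d : ℕ} (S : Finset (Fin (m - 1)))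
    (v : (S × Fin d) ⊕ ((Sᶜ : Finset (Fin (m - 1))) × Fin d) → ℝ) (j : Fin d)
    (F : Fin (m - 1) → ℝ → ℝ) :
    ∑ e, F e (unstack S Sᶜ (fun _ h => Finset.mem_compl.2 h) v j e) =
      ∑ e : S, F e (v (Sum.inl (e, j))) +
        ∑ e : (Sᶜ : Finset (Fin (m - 1))), F e (v (Sum.inr (e, j))) := by
  rw [← Finset.sum_add_sum_compl S, ← Finset.sum_coe_sort S, ← Finset.sum_coe_sort Sᶜ]
  congr 1
  · refine Finset.sum_congr rfl fun e _ => ?_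
    simp [unstack]
  · refine Finset.sum_congr rfl fun e _ => ?_
    have : e.val ∉ S := Finset.mem_compl.1 e.property
    simp [unstack, this]

lemma transpose_fromRows_mulVec {m d : ℕ} (L : ℝ) (S : Finset (Fin (m - 1)))
    (v : (S × Fin d) ⊕ ((Sᶜ : Finset (Fin (m - 1))) × Fin d) → ℝ) (i : Fin m) (j : Fin d) :
    ((Matrix.fromRows (blockMatrix m d L S) (blockMatrix m d L Sᶜ)).transpose.mulVec v) (i, j)
      = (m : ℝ) * L * (edgeSeq (unstack S Sᶜ (fun _ h => Finset.mem_compl.2 h) v j) i.val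
        - edgeSeq (unstack S Sᶜ (fun _ h => Finset.mem_compl.2 h) v j) (i.val + 1)) := by
  rw [← sum_J_mul, sum_unstack S v j (fun e y => J m e i * y)]
  simp only [Matrix.mulVec, dotProduct, Fintype.sum_sum_type, Matrix.transpose_apply,
    Matrix.fromRows_apply_inl, Matrix.fromRows_apply_inr, Fintype.sum_prod_type,
    blockMatrix_apply, mul_add, Finset.mul_sum]
  congr 1
  · refine Finset.sum_congr rfl fun e _ => ?_
    rw [Finset.sum_eq_single j]
    · simp; ring
    · intro k _ hk; simp [hk]
    · simp
  · refine Finset.sum_congr rfl fun e _ => ?_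
    rw [Finset.sum_eq_single j]
    · simp; ring
    · intro k _ hk; simp [hk]
    · simp

lemma sum_unstack_sq {m d : ℕ} (S : Finset (Fin (m - 1)))
    (v : (S × Fin d) ⊕ ((Sᶜ : Finset (Fin (m - 1))) × Fin d) → ℝ) :
    ∑ j, ∑ e, unstack S Sᶜ (fun _ h => Finset.mem_compl.2 h) v j e ^ 2 = v ⬝ᵥ v := by
  simp only [sum_unstack S v _ (fun _ y => y ^ 2), Finset.sum_add_distrib, dotProduct,
    Fintype.sum_sum_type, Fintype.sum_prod_type, ← sq]
  rw [Finset.sum_comm]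
  congr 1
  rw [Finset.sum_comm]

/-- For an eigenvector `v`, `l ‖v‖² = ‖Bᵀv‖²`, and `Bᵀv` is `mL` times the increments of a sequence
vanishing at both ends. The increments have squared norm at most `4‖v‖²` and, by the Poincaré
inequality, at least `‖v‖² / m²`. -/
lemma spectrum_stacked {m d : ℕ} {L : ℝ} {S : Finset (Fin (m - 1))} {l : ℝ}
    (hl : l ∈ spectrum ℝ (Matrix.fromRows (blockMatrix m d L S) (blockMatrix m d L Sᶜ) *
      (Matrix.fromRows (blockMatrix m d L S) (blockMatrix m d L Sᶜ)).transpose)) :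
    L ^ 2 ≤ l ∧ l ≤ 4 * m ^ 2 * L ^ 2 := by
  set B := Matrix.fromRows (blockMatrix m d L S) (blockMatrix m d L Sᶜ) with hB
  rw [← Matrix.spectrum_toLin', ← Module.End.hasEigenvalue_iff_mem_spectrum] at hl
  obtain ⟨v, hv⟩ := hl.exists_hasEigenvector
  have hv1 := hv.apply_eq_smul
  rw [Matrix.toLin'_apply, ← Matrix.mulVec_mulVec] at hv1
  have h1 : B.transpose.mulVec v ⬝ᵥ B.transpose.mulVec v = l * (v ⬝ᵥ v) := by
    have := congrArg (fun y => v ⬝ᵥ y) hv1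
    simp only [dotProduct_smul, smul_eq_mul] at this
    rw [← this, Matrix.dotProduct_mulVec v B, Matrix.mulVec_transpose]
  have hpos : 0 < v ⬝ᵥ v := by
    have h0 : v ⬝ᵥ v ≠ 0 := fun h => hv.2 (dotProduct_self_eq_zero.1 h)
    have : 0 ≤ v ⬝ᵥ v := Finset.sum_nonneg fun _ _ => mul_self_nonneg _
    exact lt_of_le_of_ne this h0.symm
  have h2 : B.transpose.mulVec v ⬝ᵥ B.transpose.mulVec v = ((m : ℝ) * L) ^ 2 *
      ∑ j, ∑ i ∈ Finset.range m,
        (edgeSeq (unstack S Sᶜ (fun _ h => Finset.mem_compl.2 h) v j) i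
        - edgeSeq (unstack S Sᶜ (fun _ h => Finset.mem_compl.2 h) v j) (i + 1)) ^ 2 := by
    simp only [dotProduct, Fintype.sum_prod_type]
    rw [Finset.sum_comm, Finset.mul_sum]
    refine Finset.sum_congr rfl fun j _ => ?_
    rw [← Fin.sum_univ_eq_sum_range (fun i =>
      (edgeSeq (unstack S Sᶜ (fun _ h => Finset.mem_compl.2 h) v j) i
        - edgeSeq (unstack S Sᶜ (fun _ h => Finset.mem_compl.2 h) v j) (i + 1)) ^ 2),
      Finset.mul_sum]
    refine Finset.sum_congr rfl fun i _ => ?_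
    rw [transpose_fromRows_mulVec]; ring
  have hz : ∀ w : Fin (m - 1) → ℝ, edgeSeq w 0 = 0 := fun w => by simp [edgeSeq]
  have hz' : ∀ w : Fin (m - 1) → ℝ, edgeSeq w m = 0 := fun w => by simp [edgeSeq]
  set Q := ∑ j, ∑ i ∈ Finset.range m,
        (edgeSeq (unstack S Sᶜ (fun _ h => Finset.mem_compl.2 h) v j) i
        - edgeSeq (unstack S Sᶜ (fun _ h => Finset.mem_compl.2 h) v j) (i + 1)) ^ 2 with hQ
  have h3 : Q ≤ 4 * (v ⬝ᵥ v) := by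
    rw [← sum_unstack_sq S v, Finset.mul_sum]
    refine Finset.sum_le_sum fun j _ => ?_
    rw [← sum_edgeSeq_sq]
    exact sum_sub_succ_sq_le _ _ (hz _) (hz' _)
  have h4 : v ⬝ᵥ v ≤ (m : ℝ) ^ 2 * Q := by
    rw [← sum_unstack_sq S v, Finset.mul_sum]
    refine Finset.sum_le_sum fun j _ => ?_
    rw [← sum_edgeSeq_sq]
    exact sum_sq_le_mul_sum_sub_succ_sq _ _ (hz _)
  rw [h1] at h2
  constructor
  · refine le_of_mul_le_mul_right ?_ hpos
    rw [h2]
    nlinarith [mul_le_mul_of_nonneg_left h4 (sq_nonneg L)]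
  · refine le_of_mul_le_mul_right ?_ hpos
    rw [h2]
    nlinarith [mul_le_mul_of_nonneg_left h3 (sq_nonneg ((m : ℝ) * L))]

lemma jointCond_le {ε L : ℝ} (hL : 0 < L) (m₁ m₂ dbar : ℕ) (β : ℝ) :
    (hardInstance ε L m₁ m₂ dbar β).jointCond ≤ 2 * ((3 * m₁ * m₂ : ℕ) : ℝ) := by
  rw [Problem.jointCond, condNumber]
  refine Real.sqrt_le_iff.2 ⟨by positivity, ?_⟩
  simp only [hardInstance]
  set m := 3 * m₁ * m₂
  set σ := spectrum ℝ (Matrix.fromRows (blockMatrix m dbar L (setM m₁ m₂))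
    (blockMatrix m dbar L (setM m₁ m₂)ᶜ) * (Matrix.fromRows (blockMatrix m dbar L (setM m₁ m₂))
    (blockMatrix m dbar L (setM m₁ m₂)ᶜ)).transpose) with hσ
  have hup : sSup σ ≤ 4 * m ^ 2 * L ^ 2 :=
    Real.sSup_le (fun l hl => (spectrum_stacked hl).2) (by positivity)
  rcases Set.eq_empty_or_nonempty {l | l ∈ σ ∧ 0 < l} with he | hne
  -- Without positive eigenvalues the infimum is `0` by convention and so is the quotient.
  · rw [he, Real.sInf_empty, div_zero]; positivity
  · have hlow : L ^ 2 ≤ sInf {l | l ∈ σ ∧ 0 < l} :=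
      le_csInf hne fun l hl => (spectrum_stacked hl.1).1
    have hL2 : 0 < L ^ 2 := by positivity
    rw [div_le_iff₀ (hL2.trans_le hlow)]
    refine hup.trans ?_
    calc 4 * (m : ℝ) ^ 2 * L ^ 2 = (2 * (m : ℝ)) ^ 2 * L ^ 2 := by ring
      _ ≤ _ := mul_le_mul_of_nonneg_left hlow (by positivity)

/-! ### Propagation of nonzero coordinates -/

/-- The number of half-iterations needed before the coordinate `k` of the block `i` (both counted
from zero) can be nonzero. -/
def delay (N i k : ℕ) : ℕ :=
  if k = 0 then 0 else (k - 1) * N + if Odd k then min N (i + 1 - N) else min N (2 * N - i)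

/-- With `delay_le_succ`: the delay changes by at most one between neighbouring blocks, so
exchanging information along an edge costs one half-iteration. Across the middle third it climbs
from `(k - 1)N` to `kN`, starting from the third that carries the link into coordinate `k ≥ 1`. -/
lemma delay_succ_le (N i k : ℕ) : delay N (i + 1) k ≤ delay N i k + 1 := by
  unfold delay; split_ifs <;> omega

lemma delay_le_succ (N i k : ℕ) : delay N i k ≤ delay N (i + 1) k + 1 := by
  unfold delay; split_ifs <;> omega

/-- Where the link from `k` to `k + 1` is present, the delay of `k` is on its upper plateau `kN`,
which is the lower plateau for `k + 1`. -/
lemma delay_le_of_weight_ne_zero {d N i k : ℕ} (h : weight d N (i + 1) (k + 2) ≠ 0) :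
    delay N i (k + 1) ≤ delay N i k + 1 := by
  have h1 : (i + 1 ≤ N ∧ Even (k + 2)) ∨ (2 * N < i + 1 ∧ Odd (k + 2)) := by
    by_contra hc
    apply h
    simp only [weight, hc, and_false, if_false]
    simp
  rcases k with _ | k
  · rcases h1 with ⟨h1, -⟩ | ⟨-, h1⟩
    · simp [delay]; omega
    · exact absurd h1 (by decide)
  · have e : (k + 1) * N = k * N + N := by ring
    rcases h1 with ⟨h1, h2⟩ | ⟨h1, h2⟩
    · have h3 : ¬ Odd (k + 1) := by
        rw [Nat.not_odd_iff_even]; simpa [Nat.even_add, parity_simps] using h2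
      have h4 : Odd (k + 1 + 1) := by
        rw [Nat.odd_add_one]; exact h3
      simp only [delay, h3, h4, if_true, if_false]
      simp; omega
    · have h3 : Odd (k + 1) := by
        by_contra h3
        have h5 : Odd (k + 1 + 1) := by rw [Nat.odd_add_one]; exact h3
        rw [show k + 1 + 2 = (k + 1 + 1) + 1 by ring, Nat.odd_add_one] at h2
        exact h2 h5
      have h4 : ¬ Odd (k + 1 + 1) := by rw [Nat.odd_add_one]; simpa using h3
      simp only [delay, h3, h4, if_true, if_false]
      simp; omega

lemma le_delay (N i k : ℕ) : (k - 1) * N ≤ delay N i k := by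
  unfold delay
  split_ifs with h
  · simp [h]
  · exact Nat.le_add_right _ _
  · exact Nat.le_add_right _ _

/-- The vectors whose coordinates vanish where the delay exceeds `τ`. -/
def early (N m d τ : ℕ) : Submodule ℝ (EuclideanSpace ℝ (Fin m × Fin d)) where
  carrier := {x | ∀ i k, τ < delay N i.val k.val → x (i, k) = 0}
  add_mem' hx hy i k h := by rw [PiLp.add_apply, hx i k h, hy i k h, add_zero]
  zero_mem' _ _ _ := rfl
  smul_mem' c x hx i k h := by rw [PiLp.smul_apply, hx i k h, smul_zero]

lemma early_mono {N m d τ τ' : ℕ} (h : τ ≤ τ') : early N m d τ ≤ early N m d τ' :=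
  fun _ hx i k hk => hx i k (h.trans_lt hk)

lemma delay_hi_le {m : ℕ} (N k : ℕ) (e : Fin (m - 1)) :
    delay N (hi e).val k ≤ delay N (lo e).val k + 1 := delay_succ_le N e.val k

lemma delay_lo_le {m : ℕ} (N k : ℕ) (e : Fin (m - 1)) :
    delay N (lo e).val k ≤ delay N (hi e).val k + 1 := delay_le_succ N e.val k

/-- The coordinate is zero, so the link to its successor is flat. The link from its predecessor is
either absent, or the delay comparison makes the predecessor zero too and this link is flat as well.
-/
lemma partialH_eq_zero {d N i τ : ℕ} {z : Fin d → ℝ} (hz : ∀ k : Fin d, τ < delay N i k.val → z k = 0)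
    {k : Fin d} (hk : τ + 1 < delay N i k.val) : partialH N (i + 1) z k = 0 := by
  have h0 : z k = 0 := hz k (by omega)
  obtain ⟨k, hkd⟩ := k
  rcases k with _ | k
  · simp [delay] at hk
  · rw [partialH, h0, linkFst_zero, mul_zero, add_zero]
    by_cases hw : weight d N (i + 1) (k + 2) = 0
    · simp only
      rw [hw, zero_mul]
    · have h1 := delay_le_of_weight_ne_zero hw
      have h2 := hz ⟨k, by omega⟩ (by simp at hk ⊢; omega)
      have h3 : ext z (k + 1) = 0 := by rw [← h2, ← ext_succ z ⟨k, by omega⟩]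
      simp only [h3, linkSnd_zero, mul_zero]

lemma mv_transpose_mv_mem_early {N m d τ : ℕ} (L : ℝ) (S : Finset (Fin (m - 1)))
    {x : EuclideanSpace ℝ (Fin m × Fin d)} (hx : x ∈ early N m d τ) :
    mv (blockMatrix m d L S).transpose (mv (blockMatrix m d L S) x) ∈ early N m d (τ + 1) := by
  intro i k hk
  rw [mv_transpose_blockMatrix]
  refine Finset.sum_eq_zero fun e _ => ?_
  rw [mv_blockMatrix, J_eq]
  have h1 := delay_hi_le N k.val e.val
  have h2 := delay_lo_le N k.val e.val
  by_cases hh : i = hi e.val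
  · rw [hh] at hk
    rw [hx (hi e.val) k (by omega), hx (lo e.val) k (by omega)]; simp
  · by_cases hl : i = lo e.val
    · rw [hl] at hk
      rw [hx (hi e.val) k (by omega), hx (lo e.val) k (by omega)]; simp
    · simp [hh, hl]

/-- A proximal point of the edge variation vanishes on every set of coordinates that is closed under
adjacency along `S` and on which the argument vanishes. -/
lemma prox_edgeVariation_eq_zero {m d : ℕ} {β η : ℝ} (hβ : 0 ≤ β) (hη : 0 < η)
    {S : Finset (Fin (m - 1))} {ξ p : EuclideanSpace ℝ (Fin m × Fin d)}
    (hp : p ∈ prox η (fun x => ((edgeVariation β S x : ℝ) : EReal)) ξ)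
    (Z : Fin m × Fin d → Prop) (hZ : ∀ e ∈ S, ∀ j, Z (hi e, j) ↔ Z (lo e, j))
    (hξ : ∀ c, Z c → ξ c = 0) (c : Fin m × Fin d) (hc : Z c) : p c = 0 := by
  classical
  by_contra hpc
  -- Zeroing `p` on `Z` gives a better competitor: an edge has both ends in `Z` or neither, so the
  -- variation does not grow, while the distance to `ξ` strictly drops.
  let q : EuclideanSpace ℝ (Fin m × Fin d) := WithLp.toLp 2 fun c => if Z c then 0 else p c
  have hq : ∀ c, q c = if Z c then 0 else p c := fun _ => rfl
  have h1 : edgeVariation β S q ≤ edgeVariation β S p := by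
    refine mul_le_mul_of_nonneg_left ?_ hβ
    refine Finset.sum_le_sum fun e he => Finset.sum_le_sum fun j _ => ?_
    rw [hq, hq]
    by_cases h : Z (lo e, j)
    · rw [if_pos h, if_pos ((hZ e he j).2 h)]; simp
    · rw [if_neg h, if_neg (mt (hZ e he j).1 h)]
  have h2 : ‖q - ξ‖ ^ 2 < ‖p - ξ‖ ^ 2 := by
    rw [EuclideanSpace.norm_sq_eq, EuclideanSpace.norm_sq_eq]
    refine Finset.sum_lt_sum (fun c _ => ?_) ⟨c, Finset.mem_univ _, ?_⟩
    · rw [PiLp.sub_apply, PiLp.sub_apply, hq]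
      split_ifs with h
      · rw [hξ c h]; simpa using sq_nonneg (p c)
      · exact le_rfl
    · rw [PiLp.sub_apply, PiLp.sub_apply, hq, if_pos hc, hξ c hc]
      simp only [sub_zero, norm_zero]
      have : 0 < ‖p c‖ := norm_pos_iff.2 hpc
      nlinarith
  have h3 := hp q
  dsimp only at h3
  rw [← EReal.coe_add, ← EReal.coe_add, EReal.coe_le_coe_iff] at h3
  have h4 : 0 < 1 / (2 * η) := by positivity
  nlinarith

section Instance

variable {ε L : ℝ} {m₁ m₂ dbar : ℕ} {β : ℝ}

lemma gradient_mem_early {τ : ℕ} (hd : Odd dbar)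
    {x : EuclideanSpace ℝ (Fin (3 * m₁ * m₂) × Fin dbar)}
    (hx : x ∈ early (m₁ * m₂) (3 * m₁ * m₂) dbar τ) :
    gradient (hardInstance ε L m₁ m₂ dbar β).f₀ x
      ∈ early (m₁ * m₂) (3 * m₁ * m₂) dbar (τ + 1) := by
  intro i k hk
  rw [gradient_f₀ hd, partialH_eq_zero (τ := τ) _ hk, mul_zero]
  intro k' hk'
  rw [block, hx i k' hk', mul_zero]

lemma not_mem_setM_of_succ (hm : 2 ≤ m₁) {e e' : Fin (3 * m₁ * m₂ - 1)}
    (he : e ∈ setM m₁ m₂) (he' : e' ∈ setM m₁ m₂) : e'.val ≠ e.val + 1 := by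
  intro h
  rw [mem_setM] at he he'
  rw [h] at he'
  have := (Nat.dvd_add_right he).1 he'
  have := Nat.le_of_dvd one_pos this
  omega

lemma prox_mem_early {τ : ℕ} (hL : 0 < L) (hm : 2 ≤ m₁) (hN : 0 < m₁ * m₂) (hβ : 0 ≤ β) {η : ℝ}
    (hη : 0 < η) {ξ p : EuclideanSpace ℝ (Fin (3 * m₁ * m₂) × Fin dbar)}
    (hξ : ξ ∈ early (m₁ * m₂) (3 * m₁ * m₂) dbar τ)
    (hp : p ∈ prox η (hardInstance ε L m₁ m₂ dbar β).g ξ) :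
    p ∈ early (m₁ * m₂) (3 * m₁ * m₂) dbar (τ + 1) := by
  intro i k hk
  have hg : (hardInstance ε L m₁ m₂ dbar β).g
      = fun x => ((edgeVariation β (setM m₁ m₂) x : ℝ) : EReal) :=
    funext fun x => hardInstance_g hL hN x
  rw [hg] at hp
  -- The set is coordinate `k` of block `i` and of its partner along an edge in `𝓜`. No two such
  -- edges are adjacent, so it is closed, and all its delays exceed `τ`.
  refine prox_edgeVariation_eq_zero hβ hη hp
    (fun c => c.2 = k ∧ (c.1 = i ∨ ∃ e ∈ setM m₁ m₂,
      (i = lo e ∧ c.1 = hi e) ∨ (i = hi e ∧ c.1 = lo e))) ?_ ?_ (i, k) ⟨rfl, Or.inl rfl⟩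
  · intro e he j
    have key : ∀ e' ∈ setM m₁ m₂, e'.val ≠ e.val + 1 ∧ e.val ≠ e'.val + 1 := fun e' he' =>
      ⟨not_mem_setM_of_succ hm he he', not_mem_setM_of_succ hm he' he⟩
    refine and_congr_right fun _ => ⟨?_, ?_⟩
    · rintro (h | ⟨e', he', ⟨h1, h2⟩ | ⟨h1, h2⟩⟩)
      · exact Or.inr ⟨e, he, Or.inr ⟨h.symm, rfl⟩⟩
      · left
        have : e.val = e'.val := by simpa [hi] using h2
        rw [h1, Fin.ext this]
      · have : e.val + 1 = e'.val := by simpa [hi, lo] using h2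
        exact absurd this.symm (key e' he').1
    · rintro (h | ⟨e', he', ⟨h1, h2⟩ | ⟨h1, h2⟩⟩)
      · exact Or.inr ⟨e, he, Or.inl ⟨h.symm, rfl⟩⟩
      · have : e.val = e'.val + 1 := by simpa [hi, lo] using h2
        exact absurd this (key e' he').2
      · left
        have : e.val = e'.val := by simpa [lo] using h2
        rw [h1, Fin.ext this]
  · rintro ⟨i', k'⟩ ⟨h, h'⟩
    simp only at h h'
    subst h
    apply hξ
    rcases h' with rfl | ⟨e, -, ⟨rfl, rfl⟩ | ⟨rfl, rfl⟩⟩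
    · omega
    · have := delay_lo_le (m₁ * m₂) k'.val e; omega
    · have := delay_hi_le (m₁ * m₂) k'.val e; omega

lemma iterate_mem_early (hε : 0 < ε) (hL : 0 < L) (h : Admissible ε L m₁ m₂ dbar β)
    (R : (hardInstance ε L m₁ m₂ dbar β).FOMRun 0) (t : ℕ) :
    R.x t ∈ early (m₁ * m₂) (3 * m₁ * m₂) dbar (2 * t) := by
  induction t using Nat.strong_induction_on with
  | _ t ih =>
    rcases Nat.eq_zero_or_pos t with rfl | ht
    · rw [R.init]; exact Submodule.zero_mem _
    obtain ⟨ξ, hξ, η, hη, p, hp, hx⟩ := R.step t ht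
    -- A gradient or `AᵀA` spends one half-iteration on data from steps before `t`, which raises
    -- `2(t - 1)` to `2t - 1`; the prox spends the other.
    have hξ' : ξ ∈ early (m₁ * m₂) (3 * m₁ * m₂) dbar (2 * t - 1) := by
      refine Submodule.span_le.2 ?_ hξ
      rintro v ⟨s, hs, hv⟩
      have hs' := ih s hs
      rcases hv with rfl | rfl | rfl | rfl
      · exact early_mono (by omega) hs'
      · exact early_mono (by omega) (gradient_mem_early h.odd hs')
      · have : mv (hardInstance ε L m₁ m₂ dbar β).A.transpose
            (hardInstance ε L m₁ m₂ dbar β).b = 0 := by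
          simp [mv, hardInstance]
        rw [this]; exact Submodule.zero_mem _
      · exact early_mono (by omega) (mv_transpose_mv_mem_early L _ hs')
    have hp' := prox_mem_early hL h.two_le h.mul_pos (beta_nonneg hε h) hη hξ' hp
    refine Submodule.span_le.2 ?_ hx
    rintro v (rfl | rfl)
    · exact early_mono (by omega) hξ'
    · exact early_mono (by omega) hp'

/-- Until `(d̄ - 2) m / 6` iterations have been made, the last coordinate of every block is zero. -/
lemma iterate_last_eq_zero (hε : 0 < ε) (hL : 0 < L) (h : Admissible ε L m₁ m₂ dbar β)
    (R : (hardInstance ε L m₁ m₂ dbar β).FOMRun 0) {t : ℕ}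
    (ht : 2 * t < (dbar - 2) * (m₁ * m₂)) (i : Fin (3 * m₁ * m₂)) (k : Fin dbar)
    (hk : k.val + 1 = dbar) : R.x t (i, k) = 0 := by
  refine iterate_mem_early hε hL h R t i k (ht.trans_le ?_)
  have := le_delay (m₁ * m₂) i.val k.val
  rwa [show k.val - 1 = dbar - 2 by omega] at this

end Instance

/-! ### Stationary points of the hard instance -/

/-- The indicator of the coordinate `j` of the blocks `i < c` (counted from zero). -/
def cut {m d : ℕ} (c : ℕ) (j : Fin d) : EuclideanSpace ℝ (Fin m × Fin d) :=
  WithLp.toLp 2 fun q => if q.2 = j then (if q.1.val < c then 1 else 0) else 0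

lemma cut_apply {m d : ℕ} (c : ℕ) (j : Fin d) (i : Fin m) (k : Fin d) :
    cut c j (i, k) = if k = j then (if i.val < c then 1 else 0) else 0 := rfl

lemma norm_cut_le {m d : ℕ} (c : ℕ) (j : Fin d) :
    ‖(cut c j : EuclideanSpace ℝ (Fin m × Fin d))‖ ≤ Real.sqrt m := by
  refine Real.le_sqrt_of_sq_le ?_
  rw [EuclideanSpace.norm_sq_eq, Fintype.sum_prod_type]
  calc _ ≤ ∑ i : Fin m, (1 : ℝ) := by
        refine Finset.sum_le_sum fun i _ => ?_
        rw [Finset.sum_eq_single j]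
        · rw [cut_apply]; split_ifs <;> simp
        · intro k _ hk; rw [cut_apply, if_neg hk]; simp
        · simp
    _ = m := by simp

lemma inner_cut {m d : ℕ} (w : EuclideanSpace ℝ (Fin m × Fin d)) (c : ℕ) (j : Fin d) :
    ⟪w, cut c j⟫_ℝ = ∑ i : Fin m, if i.val < c then w (i, j) else 0 := by
  rw [PiLp.inner_apply, Fintype.sum_prod_type]
  refine Finset.sum_congr rfl fun i _ => ?_
  rw [Finset.sum_eq_single j]
  · rw [cut_apply, if_pos rfl]; split_ifs <;> simp
  · intro k _ hk; rw [cut_apply, if_neg hk]; simp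
  · simp

lemma cut_hi_sub_lo {m d : ℕ} (c : ℕ) (j k : Fin d) (e : Fin (m - 1)) :
    (cut c j : EuclideanSpace ℝ (Fin m × Fin d)) (hi e, k) - cut c j (lo e, k)
      = if e.val + 1 = c then (if k = j then -1 else 0) else 0 := by
  simp only [cut_apply, hi, lo]
  split_ifs <;> first | omega | simp

lemma mv_blockMatrix_cut {m d : ℕ} (L : ℝ) {S : Finset (Fin (m - 1))} {c : ℕ}
    (hc : ∀ e ∈ S, e.val + 1 ≠ c) (j : Fin d) : mv (blockMatrix m d L S) (cut c j) = 0 := by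
  ext ⟨e, k⟩
  rw [mv_blockMatrix, cut_hi_sub_lo, if_neg (hc e e.property)]
  simp

lemma edgeVariation_add_smul_cut {m d : ℕ} (β : ℝ) {S : Finset (Fin (m - 1))} {c : ℕ}
    (hc : ∀ e ∈ S, e.val + 1 ≠ c) (j : Fin d) (r : ℝ) (x : EuclideanSpace ℝ (Fin m × Fin d)) :
    edgeVariation β S (x + r • cut c j) = edgeVariation β S x := by
  unfold edgeVariation
  congr 1
  refine Finset.sum_congr rfl fun e he => Finset.sum_congr rfl fun k _ => ?_
  have := cut_hi_sub_lo c j k e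
  rw [if_neg (hc e he)] at this
  simp only [PiLp.add_apply, PiLp.smul_apply, smul_eq_mul]
  congr 1
  linear_combination r * this

/-- Lifting all blocks up to the edge by its jump closes that jump and leaves every other difference
unchanged. -/
lemma edgeVariation_close_edge {m d : ℕ} (β : ℝ) {S : Finset (Fin (m - 1))} {e : Fin (m - 1)}
    (he : e ∈ S) (j : Fin d) (x : EuclideanSpace ℝ (Fin m × Fin d)) :
    edgeVariation β S (x + (x (hi e, j) - x (lo e, j)) • cut (e.val + 1) j)
      = edgeVariation β S x - β * |x (hi e, j) - x (lo e, j)| := by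
  unfold edgeVariation
  rw [← mul_sub]
  congr 1
  set r := x (hi e, j) - x (lo e, j) with hr
  set y : EuclideanSpace ℝ (Fin m × Fin d) := x + r • cut (e.val + 1) j with hy
  have h1 : ∀ e' ∈ S, ∀ k, |y (hi e', k) - y (lo e', k)| = |x (hi e', k) - x (lo e', k)|
        - if e' = e then (if k = j then |r| else 0) else 0 := by
    intro e' _ k
    have h := cut_hi_sub_lo (e.val + 1) j k e'
    have h' : y (hi e', k) - y (lo e', k)
        = x (hi e', k) - x (lo e', k) +
          r * (if e'.val + 1 = e.val + 1 then (if k = j then -1 else 0) else 0) := by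
      rw [← h, hy]; simp only [PiLp.add_apply, PiLp.smul_apply, smul_eq_mul]; ring
    rw [h']
    by_cases hee : e' = e
    · subst hee
      by_cases hk : k = j
      · subst hk; simp [← hr]
      · simp [hk]
    · have : ¬ e'.val = e.val := fun h => hee (Fin.ext h)
      simp [hee, this]
  rw [Finset.sum_congr rfl fun e' he' => Finset.sum_congr rfl fun k _ => h1 e' he' k]
  simp only [Finset.sum_sub_distrib]
  congr 1
  rw [Finset.sum_eq_single e]
  · simp
  · intro e' _ h; simp [h]
  · intro h; exact absurd he h

lemma inner_le_of_mem_subdiff {E : Type*} [NormedAddCommGroup E] [InnerProductSpace ℝ E]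
    {f : E → ℝ} {x v : E} (hv : v ∈ subdiff (fun y => (f y : EReal)) x) (u : E) :
    ⟪v, u⟫_ℝ ≤ f (x + u) - f x := by
  have h := hv (x + u)
  dsimp only at h
  rw [add_sub_cancel_left, ← EReal.coe_add, EReal.coe_le_coe_iff] at h
  linarith

/-- The regularizer is constant in both directions `± cut c j`, so the subgradient inequality
becomes an equality. -/
lemma inner_cut_eq_zero_of_mem_subdiff {m d : ℕ} {β : ℝ} {S : Finset (Fin (m - 1))}
    {x v : EuclideanSpace ℝ (Fin m × Fin d)}
    (hv : v ∈ subdiff (fun y => ((edgeVariation β S y : ℝ) : EReal)) x) {c : ℕ}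
    (hc : ∀ e ∈ S, e.val + 1 ≠ c) (j : Fin d) : ⟪v, cut c j⟫_ℝ = 0 := by
  have h1 := inner_le_of_mem_subdiff hv ((1 : ℝ) • cut c j)
  have h2 := inner_le_of_mem_subdiff hv ((-1 : ℝ) • cut c j)
  rw [edgeVariation_add_smul_cut β hc, inner_smul_right] at h1 h2
  linarith

/-- Closing a nonzero jump `r` lowers the regularizer by `β|r|`, which the subgradient must account
for. -/
lemma le_abs_inner_cut_of_mem_subdiff {m d : ℕ} {β : ℝ} {S : Finset (Fin (m - 1))}
    {x v : EuclideanSpace ℝ (Fin m × Fin d)}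
    (hv : v ∈ subdiff (fun y => ((edgeVariation β S y : ℝ) : EReal)) x) {e : Fin (m - 1)}
    (he : e ∈ S) {j : Fin d} (hx : x (hi e, j) ≠ x (lo e, j)) :
    β ≤ |⟪v, cut (e.val + 1) j⟫_ℝ| := by
  have h1 := inner_le_of_mem_subdiff hv ((x (hi e, j) - x (lo e, j)) • cut (e.val + 1) j)
  rw [edgeVariation_close_edge β he, inner_smul_right] at h1
  set r := x (hi e, j) - x (lo e, j) with hr
  have hr0 : 0 < |r| := abs_pos.2 (sub_ne_zero.2 hx)
  have h2 : |r| * β ≤ |r| * |⟪v, cut (e.val + 1) j⟫_ℝ| := by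
    rw [← abs_mul]
    linarith [neg_abs_le (r * ⟪v, cut (e.val + 1) j⟫_ℝ)]
  exact le_of_mul_le_mul_left h2 hr0

lemma sq_sub_le_mul_sum_sq (X : ℕ → ℝ) {m a b : ℕ} (hab : a ≤ b) (hb : b ≤ m - 1) :
    (X b - X a) ^ 2 ≤ m * ∑ i ∈ Finset.range (m - 1), (X (i + 1) - X i) ^ 2 := by
  have e : X b - X a = ∑ i ∈ Finset.Ico a b, (X (i + 1) - X i) := by
    rw [Finset.sum_Ico_eq_sub _ hab, Finset.sum_range_sub, Finset.sum_range_sub]; ring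
  rw [e]
  have h2 := sq_sum_le_card_mul_sum_sq (s := Finset.Ico a b) (f := fun i => X (i + 1) - X i)
  refine h2.trans (mul_le_mul ?_ ?_ (Finset.sum_nonneg fun _ _ => sq_nonneg _) (by positivity))
  · rw [Nat.card_Ico]; exact_mod_cast (by omega : b - a ≤ m)
  · refine Finset.sum_le_sum_of_subset_of_nonneg (fun i hi => ?_) fun _ _ _ => sq_nonneg _
    rw [Finset.mem_Ico] at hi
    rw [Finset.mem_range]; omega

/-- On a path, two values differ by at most `√m` times the `ℓ²` norm of the increments. -/
lemma sq_sub_le_mul_sum_edges {m : ℕ} (y : Fin m → ℝ) (i i' : Fin m) :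
    (y i - y i') ^ 2 ≤ m * ∑ e : Fin (m - 1), (y (hi e) - y (lo e)) ^ 2 := by
  let X : ℕ → ℝ := fun n => if h : n < m then y ⟨n, h⟩ else 0
  have hX : ∀ i : Fin m, X i.val = y i := fun i => by simp [X]
  have h1 : ∑ e : Fin (m - 1), (y (hi e) - y (lo e)) ^ 2
      = ∑ i ∈ Finset.range (m - 1), (X (i + 1) - X i) ^ 2 := by
    rw [← Fin.sum_univ_eq_sum_range (fun i => (X (i + 1) - X i) ^ 2)]
    refine Finset.sum_congr rfl fun e _ => ?_
    rw [← hX (hi e), ← hX (lo e)]; rfl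
  rw [h1, ← hX, ← hX]
  rcases le_total i'.val i.val with h | h
  · exact sq_sub_le_mul_sum_sq X h (by omega)
  · rw [sub_sq_comm]; exact sq_sub_le_mul_sum_sq X h (by omega)

/-- Take the first small coordinate; if it is the very first, the padded value `1` serves as its
large predecessor. -/
lemma exists_abs_lt_one_le_abs_ext {d : ℕ} {z : Fin d → ℝ} {k : Fin d} (hk : |z k| < 1) :
    ∃ j : Fin d, |z j| < 1 ∧ 1 ≤ |ext z j.val| := by
  classical
  have hex : ∃ n, ∃ h : n < d, |z ⟨n, h⟩| < 1 := ⟨k.val, k.isLt, hk⟩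
  obtain ⟨h1, h2⟩ := Nat.find_spec hex
  refine ⟨⟨Nat.find hex, h1⟩, h2, ?_⟩
  by_cases h0 : Nat.find hex = 0
  · simp [h0, ext_zero]
  · obtain ⟨n, hn⟩ := Nat.exists_eq_succ_of_ne_zero h0
    have h3 := Nat.find_min hex (m := n) (by omega)
    push Not at h3
    have h4 := h3 (by omega)
    simp only [hn]
    rwa [← ext_succ z ⟨n, by omega⟩] at h4

/-- By `sum_weight` the second-slot terms total `m` times a slope below `-1`; the first-slot terms
are nonpositive. -/
lemma sum_partialH_lt {m N d : ℕ} (hm : m = 3 * N) (hN : 0 < N) {z : Fin d → ℝ} {j : Fin d}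
    (h1 : |z j| < 1) (h2 : 1 ≤ |ext z j.val|) :
    ∑ i : Fin m, partialH N (i.val + 1) z j < -(m : ℝ) := by
  simp only [partialH, Finset.sum_add_distrib, ← Finset.sum_mul]
  rw [sum_weight hm (by omega)]
  have h3 : 0 ≤ ∑ i : Fin m, weight d N (i.val + 1) (j.val + 2) :=
    Finset.sum_nonneg fun _ _ => weight_nonneg _ _ _ _
  have h4 := linkFst_nonpos (z j) (ext z (j.val + 2))
  have h5 := linkSnd_lt_neg_one h2 h1
  have h6 : (0 : ℝ) < m := by exact_mod_cast (by omega : 0 < m)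
  nlinarith [mul_nonpos_of_nonneg_of_nonpos h3 h4]

section Instance

variable {ε L : ℝ} {m₁ m₂ dbar : ℕ} {β : ℝ}

/-- A cut at a level that is no edge of `A` lies in the kernel of `A`, so the multiplier drops out.
The slack `ε < ε'` yields an actual subgradient from the distance, without attainment. -/
lemma exists_subgradient_of_isStationary (hε : 0 < ε) (hL : 0 < L) (hN : 0 < m₁ * m₂)
    {x : EuclideanSpace ℝ (Fin (3 * m₁ * m₂) × Fin dbar)}
    (hx : (hardInstance ε L m₁ m₂ dbar β).IsStationary ε x) {ε' : ℝ} (hε' : ε < ε') {c : ℕ}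
    (hc : ∀ e ∈ (setM m₁ m₂)ᶜ, e.val + 1 ≠ c) (j : Fin dbar) :
    ∃ v ∈ subdiff (fun y => ((edgeVariation β (setM m₁ m₂) y : ℝ) : EReal)) x,
      |⟪gradient (hardInstance ε L m₁ m₂ dbar β).f₀ x, cut c j⟫_ℝ + ⟪v, cut c j⟫_ℝ|
        < ε' * Real.sqrt ((3 * m₁ * m₂ : ℕ) : ℝ) := by
  have hm : (0 : ℝ) < ((3 * m₁ * m₂ : ℕ) : ℝ) := by
    rw [three_mul_eq]; exact_mod_cast (by omega : 0 < 3 * (m₁ * m₂))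
  obtain ⟨γ, h1, -⟩ := hx
  have h2 := h1.trans_lt ((ENNReal.ofReal_lt_ofReal_iff (hε.trans hε')).2 hε')
  rw [Metric.infEDist_lt_iff] at h2
  obtain ⟨-, ⟨v, hv, rfl⟩, hw⟩ := h2
  have hg : (hardInstance ε L m₁ m₂ dbar β).g
      = fun x => ((edgeVariation β (setM m₁ m₂) x : ℝ) : EReal) :=
    funext fun x => hardInstance_g hL hN x
  rw [hg] at hv
  refine ⟨v, hv, ?_⟩
  rw [edist_dist, dist_zero_left, ENNReal.ofReal_lt_ofReal_iff (hε.trans hε')] at hw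
  have hA : ⟪mv (hardInstance ε L m₁ m₂ dbar β).A.transpose γ, cut c j⟫_ℝ = 0 := by
    rw [inner_mv_transpose]
    have : mv (hardInstance ε L m₁ m₂ dbar β).A (cut c j) = 0 := mv_blockMatrix_cut L hc j
    rw [this, inner_zero_right]
  have e : ⟪gradient (hardInstance ε L m₁ m₂ dbar β).f₀ x, cut c j⟫_ℝ + ⟪v, cut c j⟫_ℝ =
      ⟪gradient (hardInstance ε L m₁ m₂ dbar β).f₀ x
        + mv (hardInstance ε L m₁ m₂ dbar β).A.transpose γ + v, cut c j⟫_ℝ := by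
    rw [inner_add_left, inner_add_left, hA, add_zero]
  rw [e]
  refine (abs_real_inner_le_norm _ _).trans_lt ?_
  calc _ ≤ _ * Real.sqrt ((3 * m₁ * m₂ : ℕ) : ℝ) :=
        mul_le_mul_of_nonneg_left (norm_cut_le c j) (norm_nonneg _)
    _ < _ := mul_lt_mul_of_pos_right hw (Real.sqrt_pos.2 hm)

lemma abs_inner_gradient_cut_le (hε : 0 < ε) (hL : 0 < L) (hN : 0 < m₁ * m₂) (hd : Odd dbar)
    (x : EuclideanSpace ℝ (Fin (3 * m₁ * m₂) × Fin dbar)) (c : ℕ) (j : Fin dbar) :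
    |⟪gradient (hardInstance ε L m₁ m₂ dbar β).f₀ x, cut c j⟫_ℝ|
      ≤ 50 * Real.pi * Real.sqrt ((3 * m₁ * m₂ : ℕ) : ℝ) * ε := by
  have hm : (0 : ℝ) < ((3 * m₁ * m₂ : ℕ) : ℝ) := by
    rw [three_mul_eq]; exact_mod_cast (by omega : 0 < 3 * (m₁ * m₂))
  have hp := Real.pi_pos
  have hs := Real.sqrt_pos.2 hm
  rw [inner_cut]
  refine (Finset.abs_sum_le_sum_abs _ _).trans ?_
  calc _ ≤ ∑ i : Fin (3 * m₁ * m₂),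
        2 * ε / Real.sqrt ((3 * m₁ * m₂ : ℕ) : ℝ) * (25 * Real.pi) := by
        refine Finset.sum_le_sum fun i _ => ?_
        split_ifs
        · rw [gradient_f₀ hd, amp_mul_scale hε hL hN, ← three_mul_eq, abs_mul,
            abs_of_nonneg (by positivity)]
          exact mul_le_mul_of_nonneg_left (abs_partialH_le _ _ _ _) (by positivity)
        · rw [abs_zero]; positivity
    _ = _ := by
        rw [Finset.sum_const, Finset.card_univ, Fintype.card_fin, nsmul_eq_mul]
        nth_rewrite 1 [← Real.mul_self_sqrt hm.le]
        field_simp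
        norm_num

/-- At a stationary point the blocks joined by an edge in `𝓜` agree. -/
lemma eq_of_mem_setM (hε : 0 < ε) (hL : 0 < L) (h : Admissible ε L m₁ m₂ dbar β)
    {x : EuclideanSpace ℝ (Fin (3 * m₁ * m₂) × Fin dbar)}
    (hx : (hardInstance ε L m₁ m₂ dbar β).IsStationary ε x) {e : Fin (3 * m₁ * m₂ - 1)}
    (he : e ∈ setM m₁ m₂) (j : Fin dbar) : x (hi e, j) = x (lo e, j) := by
  have hN := h.mul_pos
  have hm : (0 : ℝ) < ((3 * m₁ * m₂ : ℕ) : ℝ) := by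
    rw [three_mul_eq]; exact_mod_cast (by omega : 0 < 3 * (m₁ * m₂))
  have hs := Real.sqrt_pos.2 hm
  by_contra hne
  have hβ := h.beta_gt
  have hA : 0 ≤ specNorm (hardInstance ε L m₁ m₂ dbar β).A := norm_nonneg _
  set q := Real.sqrt ((3 * m₁ * m₂ : ℕ) : ℝ) with hq
  have hβ' : (50 * Real.pi + 1) * q * ε < β := by
    nlinarith [mul_nonneg (mul_nonneg hA hs.le) hε.le]
  -- Chosen so that `ε'q = β - 50πqε`: a jump would make the subgradient contribute at least `β` and
  -- the gradient cancel at most `50πqε`.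
  have hε' : ε < (β - 50 * Real.pi * q * ε) / q := by
    rw [lt_div_iff₀ hs]; linarith
  obtain ⟨v, hv, hlt⟩ := exists_subgradient_of_isStationary hε hL hN hx hε' (c := e.val + 1)
    (fun e' he' hee => Finset.mem_compl.1 he' (by rwa [Fin.ext (by omega : e'.val = e.val)])) j
  rw [← hq, div_mul_cancel₀ _ hs.ne'] at hlt
  have h1 := le_abs_inner_cut_of_mem_subdiff hv he hne
  have h2 := abs_inner_gradient_cut_le (β := β) hε hL hN h.odd x (e.val + 1) j
  have h3 := abs_sub_abs_le_abs_add ⟪v, cut (e.val + 1) j⟫_ℝ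
    ⟪gradient (hardInstance ε L m₁ m₂ dbar β).f₀ x, cut (e.val + 1) j⟫_ℝ
  rw [add_comm ⟪v, cut (e.val + 1) j⟫_ℝ] at h3
  linarith

/-- At a stationary point all blocks nearly agree. -/
lemma abs_sub_le_of_isStationary (hε : 0 < ε) (hL : 0 < L) (h : Admissible ε L m₁ m₂ dbar β)
    {x : EuclideanSpace ℝ (Fin (3 * m₁ * m₂) × Fin dbar)}
    (hx : (hardInstance ε L m₁ m₂ dbar β).IsStationary ε x) (i i' : Fin (3 * m₁ * m₂))
    (j : Fin dbar) :
    |x (i, j) - x (i', j)| ≤ ε / (Real.sqrt ((3 * m₁ * m₂ : ℕ) : ℝ) * L) := by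
  have hN := h.mul_pos
  have hm : (0 : ℝ) < ((3 * m₁ * m₂ : ℕ) : ℝ) := by
    rw [three_mul_eq]; exact_mod_cast (by omega : 0 < 3 * (m₁ * m₂))
  have hs := Real.sqrt_pos.2 hm
  have hsq := Real.sq_sqrt hm.le
  have hM := fun e he => eq_of_mem_setM hε hL h hx (e := e) he
  obtain ⟨γ, -, hA⟩ := hx
  have h1 : ∑ e : Fin (3 * m₁ * m₂ - 1), (((3 * m₁ * m₂ : ℕ) : ℝ) * L) ^ 2 *
      (x (hi e, j) - x (lo e, j)) ^ 2 ≤ ε ^ 2 := by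
    have hb : (hardInstance ε L m₁ m₂ dbar β).b = 0 := rfl
    have h2 := pow_le_pow_left₀ (norm_nonneg _) hA 2
    rw [hb, add_zero, EuclideanSpace.norm_sq_eq, Fintype.sum_prod_type] at h2
    refine le_trans ?_ h2
    -- Edges in `𝓜` carry no jump; all others are rows of `A` and are controlled by the residual.
    rw [← Finset.sum_add_sum_compl (setM m₁ m₂), Finset.sum_eq_zero, zero_add,
      ← Finset.sum_coe_sort (setM m₁ m₂)ᶜ]
    · refine Finset.sum_le_sum fun e _ => ?_
      have h3 : ∀ k, ‖mv (hardInstance ε L m₁ m₂ dbar β).A x (e, k)‖ ^ 2 =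
          (((3 * m₁ * m₂ : ℕ) : ℝ) * L) ^ 2 * (x (hi e.val, k) - x (lo e.val, k)) ^ 2 := by
        intro k
        rw [Real.norm_eq_abs, sq_abs, ← mul_pow]
        congr 1
        exact mv_blockMatrix L _ x e k
      simp only [h3]
      exact Finset.single_le_sum (f := fun k => (((3 * m₁ * m₂ : ℕ) : ℝ) * L) ^ 2 *
        (x (hi e.val, k) - x (lo e.val, k)) ^ 2) (fun k _ => by positivity) (Finset.mem_univ j)
    · intro e he
      rw [hM e he j]; simp
  rw [← Finset.mul_sum] at h1
  have h4 := sq_sub_le_mul_sum_edges (fun i => x (i, j)) i i'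
  refine abs_le_of_sq_le_sq ?_ (by positivity)
  rw [div_pow, mul_pow, hsq, le_div_iff₀ (by positivity)]
  calc _ ≤ _ * (((3 * m₁ * m₂ : ℕ) : ℝ) * L ^ 2) :=
        mul_le_mul_of_nonneg_right h4 (by positivity)
    _ = _ := by ring
    _ ≤ _ := h1

/-- A point with a vanishing coordinate in all blocks is not close to a stationary point. -/
lemma not_isNearStationary {ω : ℝ} (hε : 0 < ε) (hL : 0 < L) (hω₀ : 0 ≤ ω)
    (hω : ω < 150 * Real.pi * ε / L) (h : Admissible ε L m₁ m₂ dbar β)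
    {x : EuclideanSpace ℝ (Fin (3 * m₁ * m₂) × Fin dbar)} {k : Fin dbar}
    (hk : ∀ i, x (i, k) = 0) : ¬ (hardInstance ε L m₁ m₂ dbar β).IsNearStationary ω ε x := by
  rintro ⟨y, hy, hxy⟩
  have hN := h.mul_pos
  have hp := Real.pi_pos
  have hmN : 0 < 3 * m₁ * m₂ := by rw [three_mul_eq]; omega
  have hm : (0 : ℝ) < ((3 * m₁ * m₂ : ℕ) : ℝ) := by exact_mod_cast hmN
  have hscale := scale_pos hε hL hN
  have hac := amp_mul_scale hε hL hN
  have hconst : scale ε L (m₁ * m₂)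
      = Real.sqrt ((3 * m₁ * m₂ : ℕ) : ℝ) * L / (150 * Real.pi * ε) := by
    rw [scale, three_mul_eq]
  have hclose := abs_sub_le_of_isStationary hε hL h hy
  rw [← three_mul_eq] at hac
  set q := Real.sqrt ((3 * m₁ * m₂ : ℕ) : ℝ) with hq
  have hs : 0 < q := Real.sqrt_pos.2 hm
  have hsq : q ^ 2 = ((3 * m₁ * m₂ : ℕ) : ℝ) := Real.sq_sqrt hm.le
  set s := scale ε L (m₁ * m₂) with hsdef
  -- a block whose `k`-th coordinate is small
  obtain ⟨i₀, hi₀⟩ : ∃ i₀ : Fin (3 * m₁ * m₂), |y (i₀, k)| ≤ ω / q := by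
    have h1 : ∑ i : Fin (3 * m₁ * m₂), y (i, k) ^ 2 ≤ ∑ i : Fin (3 * m₁ * m₂), (ω / q) ^ 2 := by
      have h2 := pow_le_pow_left₀ (norm_nonneg _) hxy 2
      rw [EuclideanSpace.norm_sq_eq, Fintype.sum_prod_type] at h2
      rw [Finset.sum_const, Finset.card_univ, Fintype.card_fin, nsmul_eq_mul, ← hsq, div_pow,
        mul_div_cancel₀ _ (by positivity)]
      refine le_trans (Finset.sum_le_sum fun i _ => ?_) h2
      refine le_trans (le_of_eq ?_) (Finset.single_le_sum (f := fun k => ‖(x - y) (i, k)‖ ^ 2)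
        (fun _ _ => by positivity) (Finset.mem_univ k))
      simp [hk i]
    obtain ⟨i₀, -, hi₀⟩ := Finset.exists_le_of_sum_le ⟨⟨0, hmN⟩, Finset.mem_univ _⟩ h1
    exact ⟨i₀, abs_le_of_sq_le_sq hi₀ (by positivity)⟩
  have hz : |block s y i₀ k| < 1 := by
    rw [block, abs_mul, abs_of_pos hscale]
    calc s * |y (i₀, k)| ≤ s * (ω / q) := mul_le_mul_of_nonneg_left hi₀ hscale.le
      _ = ω * L / (150 * Real.pi * ε) := by rw [hconst]; field_simp
      _ < 1 := by
        rw [div_lt_one (by positivity)]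
        rwa [lt_div_iff₀ hL] at hω
  obtain ⟨j, hj1, hj2⟩ := exists_abs_lt_one_le_abs_ext hz
  -- Here all `h_i` are evaluated at the single block `i₀`; passing to their own blocks costs at
  -- most `1/2` each, since rescaled blocks differ by at most `1/(150π)` and the partial derivatives
  -- have Lipschitz constant `75π`.
  have hsum := sum_partialH_lt (three_mul_eq m₁ m₂) hN hj1 hj2
  have hdiff : ∀ i : Fin (3 * m₁ * m₂), partialH (m₁ * m₂) (i.val + 1) (block s y i) j
      ≤ partialH (m₁ * m₂) (i.val + 1) (block s y i₀) j + 1 / 2 := by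
    intro i
    have h1 : ∀ k', |block s y i k' - block s y i₀ k'| ≤ s * (ε / (q * L)) := by
      intro k'
      rw [block, block, ← mul_sub, abs_mul, abs_of_pos hscale]
      exact mul_le_mul_of_nonneg_left (hclose i i₀ k') hscale.le
    have h2 := abs_partialH_sub_le_of_forall (m₁ * m₂) (i.val + 1) (by positivity) h1 j
    have h3 : 75 * Real.pi * (s * (ε / (q * L))) = 1 / 2 := by
      rw [hconst]; field_simp; norm_num
    rw [h3] at h2
    linarith [le_of_abs_le h2]
  have htot : ∑ i : Fin (3 * m₁ * m₂), partialH (m₁ * m₂) (i.val + 1) (block s y i) j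
      < -(((3 * m₁ * m₂ : ℕ) : ℝ) / 2) := by
    have h1 := Finset.sum_le_sum fun i (_ : i ∈ Finset.univ) => hdiff i
    rw [Finset.sum_add_distrib, Finset.sum_const, Finset.card_univ, Fintype.card_fin,
      nsmul_eq_mul] at h1
    linarith
  -- The cut at level `m` shifts the coordinate in all blocks and crosses no edge, so both the
  -- multiplier and the subgradient vanish on it.
  have hc : ∀ e : Fin (3 * m₁ * m₂ - 1), e.val + 1 ≠ 3 * m₁ * m₂ := by intro e; omega
  have hgrad : ⟪gradient (hardInstance ε L m₁ m₂ dbar β).f₀ y, cut (3 * m₁ * m₂) j⟫_ℝ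
      < -(ε * q) := by
    rw [inner_cut]
    have e1 : ∀ i : Fin (3 * m₁ * m₂), (if i.val < 3 * m₁ * m₂ then
        gradient (hardInstance ε L m₁ m₂ dbar β).f₀ y (i, j) else 0)
        = 2 * ε / q * partialH (m₁ * m₂) (i.val + 1) (block s y i) j := by
      intro i
      rw [if_pos i.isLt, gradient_f₀ h.odd, hac]
    simp only [e1, ← Finset.mul_sum]
    calc _ < 2 * ε / q * -(((3 * m₁ * m₂ : ℕ) : ℝ) / 2) :=
          mul_lt_mul_of_pos_left htot (by positivity)
      _ = _ := by rw [← hsq]; field_simp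
  set G := ⟪gradient (hardInstance ε L m₁ m₂ dbar β).f₀ y, cut (3 * m₁ * m₂) j⟫_ℝ with hG
  have hε' : ε < -G / q := by rw [lt_div_iff₀ hs]; linarith
  obtain ⟨v, hv, hlt⟩ := exists_subgradient_of_isStationary hε hL hN hy hε' (fun e _ => hc e) j
  rw [inner_cut_eq_zero_of_mem_subdiff hv (fun e _ => hc e), add_zero, ← hq, ← hG,
    div_mul_cancel₀ _ hs.ne'] at hlt
  linarith [neg_abs_le G]

/-! ### Oracle calls and comparison of constants. -/

lemma le_calls {x0 : EuclideanSpace ℝ (Fin (3 * m₁ * m₂) × Fin dbar)}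
    (R : (hardInstance ε L m₁ m₂ dbar β).FOMRun x0) (t : ℕ) : t ≤ R.calls t := by
  induction t with
  | zero => exact Nat.zero_le _
  | succ t ih => exact Nat.succ_le_of_lt (ih.trans_lt (R.calls_lt t))

/-- The bound of the theorem is at most `(d̄ - 2) m / 6`. -/
lemma bound_le (hε : 0 < ε) (hL : 0 < L) (h : Admissible ε L m₁ m₂ dbar β) :
    (hardInstance ε L m₁ m₂ dbar β).jointCond * L * (hardInstance ε L m₁ m₂ dbar β).gap 0 /
        (36000 * Real.pi ^ 2) * (ε ^ 2)⁻¹ ≤ ((dbar : ℝ) - 2) * ((m₁ * m₂ : ℕ) : ℝ) / 2 := by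
  have hN := h.mul_pos
  have hp := Real.pi_pos
  have hd : (5 : ℝ) ≤ dbar := by exact_mod_cast h.five_le
  have h1 := jointCond_le (ε := ε) hL m₁ m₂ dbar β
  have h2 := gap_le hε hL hN h.odd (beta_nonneg hε h)
  have h0 : 0 ≤ (hardInstance ε L m₁ m₂ dbar β).jointCond := Real.sqrt_nonneg _
  set κ := (hardInstance ε L m₁ m₂ dbar β).jointCond
  set Δ := (hardInstance ε L m₁ m₂ dbar β).gap 0
  have hM : ((3 * m₁ * m₂ : ℕ) : ℝ) = 3 * ((m₁ * m₂ : ℕ) : ℝ) := by push_cast; ring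
  rw [hM] at h1
  have hM0 : (0 : ℝ) ≤ ((m₁ * m₂ : ℕ) : ℝ) := Nat.cast_nonneg _
  generalize ((m₁ * m₂ : ℕ) : ℝ) = M at h1 hM0
  have h3 : κ * Δ ≤ 2 * (3 * M) * (1200 * Real.pi ^ 2 * ε ^ 2 * (dbar - 1 / 2) / L) :=
    (mul_le_mul_of_nonneg_left h2 h0).trans (mul_le_mul_of_nonneg_right h1 (by
      have : (0 : ℝ) ≤ dbar - 1 / 2 := by linarith
      positivity))
  calc κ * L * Δ / (36000 * Real.pi ^ 2) * (ε ^ 2)⁻¹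
      = (κ * Δ) * (L / (36000 * Real.pi ^ 2) * (ε ^ 2)⁻¹) := by ring
    _ ≤ 2 * (3 * M) * (1200 * Real.pi ^ 2 * ε ^ 2 * (dbar - 1 / 2) / L) *
        (L / (36000 * Real.pi ^ 2) * (ε ^ 2)⁻¹) := mul_le_mul_of_nonneg_right h3 (by positivity)
    -- The constant `36000` leaves the factor `1/5`; then `(d̄ - 1/2)/5 ≤ (d̄ - 2)/2` holds as soon
    -- as `d̄ ≥ 3`.
    _ = M * (dbar - 1 / 2) / 5 := by field_simp; ring
    _ ≤ _ := by nlinarith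

end Instance

end FOMLower

end

theorem theorem1 (ε L ω : ℝ) (hε : 0 < ε) (hL : 0 < L) (hω₀ : 0 ≤ ω)
    (hω : ω < 150 * Real.pi * ε / L) :
    (∃ (m₁ m₂ dbar : ℕ) (β : ℝ), FOMLower.Admissible ε L m₁ m₂ dbar β) ∧
    ∀ (m₁ m₂ dbar : ℕ) (β : ℝ), FOMLower.Admissible ε L m₁ m₂ dbar β →
      (FOMLower.hardInstance ε L m₁ m₂ dbar β).InClass L ∧
      ∀ (R : (FOMLower.hardInstance ε L m₁ m₂ dbar β).FOMRun 0) (t : ℕ),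
        (FOMLower.hardInstance ε L m₁ m₂ dbar β).IsNearStationary ω ε (R.x t) →
          ⌈(FOMLower.hardInstance ε L m₁ m₂ dbar β).jointCond * L *
              (FOMLower.hardInstance ε L m₁ m₂ dbar β).gap 0 / (36000 * Real.pi ^ 2) *
              (ε ^ 2)⁻¹⌉₊ ≤ R.calls t := by
  refine ⟨FOMLower.exists_admissible ε L, fun m₁ m₂ dbar β h =>
    ⟨FOMLower.hardInstance_inClass hε hL h, fun R t hnear => ?_⟩⟩
  have h5 := h.five_le
  have ht : (dbar - 2) * (m₁ * m₂) ≤ 2 * t := by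
    by_contra hlt
    refine FOMLower.not_isNearStationary hε hL hω₀ hω h (k := ⟨dbar - 1, by omega⟩)
      (fun i => ?_) hnear
    exact FOMLower.iterate_last_eq_zero hε hL h R (not_le.1 hlt) i _ (by simp; omega)
  refine (Nat.ceil_le.2 ?_).trans (FOMLower.le_calls R t)
  refine (FOMLower.bound_le hε hL h).trans ?_
  have ht' : (((dbar - 2) * (m₁ * m₂) : ℕ) : ℝ) ≤ ((2 * t : ℕ) : ℝ) := by exact_mod_cast ht
  rw [Nat.cast_mul, Nat.cast_sub (by omega), Nat.cast_mul 2 t] at ht'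
  push_cast at ht' ⊢
  linarith
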